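/- Let $\mathcal T$ be an essentially small triangulated category with suspension $\Sigma$, and let $\operatorname{Thick}\mathcal T$ be the complete lattice of its thick subcategories, ordered by inclusion (meets are intersections, and joins are the smallest thick subcategories containing the given ones). Two thick subcategories $\mathcal U,\mathcal V$ \emph{commute} if every morphism between an object of $\mathcal U$ and an object of $\mathcal V$, in either direction, factors through an object of $\mathcal U\wedge\mathcal V$. For $T\subseteq\operatorname{Thick}\mathcal T$ let $$Z(T)=\{\mathcal U\in T\mid \mathcal U\text{ commutes with every }\mathcal V\in T\}.$$ Let $\operatorname{Coh}\mathcal T$ be the category of cohomological functors $\mathcal T^{\mathrm{op}}\to\mathrm{Ab}$, with $\Sigma F=F\circ\Sigma^{-1}$; sequences in it are exact if they are exact at every object of $\mathcal T$. For $\mathcal S\in\operatorname{Thick}\mathcal T$ with quotient functor $q\colon\mathcal T\to\mathcal T/\mathcal S$ put $L_{\mathcal S}=q_*q^*$, where $q_*$ is composition with $q$ and $q^*$ is its left adjoint (left Kan extension along $q$). An inclusion $\mathcal S\subseteq\mathcal S'$ induces a canonical morphism $L_{\mathcal S}\to L_{\mathcal S'}$. \textbf{Theorem.} Let $T\subseteq\operatorname{Thick}\mathcal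 T$ be a sublattice that is closed under arbitrary joins (including the empty one). 1. $Z(T)$ is a sublattice of $\operatorname{Thick}\mathcal T$ that is closed under arbitrary joins, and $\mathcal T\in Z(T)$ if $\mathcal T\in T$. 2. $Z(T)$, ordered by inclusion, is a frame, and it is spatial: with $\operatorname{Pt}Z(T)$ the space of points, i.e. of frame morphisms $p\colon Z(T)\to\{0,1\}$, whose open sets are the sets $\{p\mid p(\mathcal U)=1\}$ with $\mathcal U\in Z(T)$, the assignment $\mathcal U\mapsto\{p\mid p(\mathcal U)=1\}$ is an isomorphism from $Z(T)$ onto the frame of open subsets of $\operatorname{Pt}Z(T)$. The space $\operatorname{Pt}Z(T)$ is sober. 3. Identify a point $p$ of $Z(T)$ with the prime element $\mathcal P=\bigvee_{p(\mathcal U)=0}\mathcal U$ of $Z(T)$, and define the central support of an object $X$ of $\mathcal T$ by $\operatorname{supp}X=\{\mathcal P\mid X\notin\mathcal P\}$ and that of a class $\mathcal X$ of objects by $\operatorname{supp}\mathcal X=\bigcup_{X\in\mathcal X}\operatorname{supp}X$. Then $\mathcal U\mapsto\operatorname{supp}\mathcal U$ is an isomorphism from $Z(T)$ onto the frame of open subsets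 of $\operatorname{Pt}Z(T)$. 4. For all $\mathcal U,\mathcal V\in T$ with at least one of them in $Z(T)$ there is an exact Mayer–Vietoris sequence of functors $\operatorname{Coh}\mathcal T\to\operatorname{Coh}\mathcal T$ $$\cdots\to\Sigma^{-1}L_{\mathcal U\vee\mathcal V}\to L_{\mathcal U\wedge\mathcal V}\to L_{\mathcal U}\oplus L_{\mathcal V}\to L_{\mathcal U\vee\mathcal V}\to\Sigma L_{\mathcal U\wedge\mathcal V}\to\cdots,$$ in which $L_{\mathcal U\wedge\mathcal V}\to L_{\mathcal U}\oplus L_{\mathcal V}$ is induced by the inclusions of $\mathcal U\wedge\mathcal V$ into $\mathcal U$ and $\mathcal V$, and $L_{\mathcal U}\oplus L_{\mathcal V}\to L_{\mathcal U\vee\mathcal V}$ is the difference of the canonical morphisms. For $T=\operatorname{Thick}\mathcal T$ this says in particular that the central thick subcategories of $\mathcal T$ form a spatial frame, and that they correspond via central support to the open subsets of the sober space $\operatorname{Spc}_{\mathrm{cent}}\mathcal T=\operatorname{Pt}Z(\operatorname{Thick}\mathcal T)$. -/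

import Mathlib

open CategoryTheory CategoryTheory.Limits Opposite
open scoped CategoryTheory.Pretriangulated ZeroObject

universe v u

noncomputable section

namespace ThickCentre

variable (C : Type u) [Category.{v} C] [HasZeroObject C] [HasShift C ℤ] [Preadditive C]
  [∀ n : ℤ, (shiftFunctor C n).Additive] [Pretriangulated C]

/-- A thick subcategory of a triangulated category `C`: a (strictly full) triangulated
subcategory that is closed under direct summands. -/
@[ext]
structure Thick where
  /-- The objects of the subcategory. -/
  carrier : ObjectProperty C
  isTriangulated : carrier.IsTriangulated
  isStableUnderRetracts : carrier.IsStableUnderRetracts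

variable {C}

attribute [instance] Thick.isTriangulated Thick.isStableUnderRetracts

namespace Thick

/-- Thick subcategories are ordered by inclusion. -/
instance : PartialOrder (Thick C) :=
  PartialOrder.lift Thick.carrier fun _ _ h => Thick.ext h

theorem le_def {U V : Thick C} : U ≤ V ↔ ∀ X : C, U.carrier X → V.carrier X := Iff.rfl

/-- The intersection of a set of thick subcategories. -/
instance : InfSet (Thick C) where
  sInf S :=
    { carrier := fun X => ∀ U ∈ S, U.carrier X
      isTriangulated :=
        { exists_zero := ⟨0, isZero_zero C, fun U _ => U.carrier.prop_zero⟩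
          isStableUnderShiftBy := fun n =>
            ⟨fun X hX U hU => U.carrier.le_shift n X (hX U hU)⟩
          ext₂' := fun T hT h₁ h₃ => ObjectProperty.le_isoClosure _ _ fun U hU =>
            U.carrier.ext_of_isTriangulatedClosed₂ T hT (h₁ U hU) (h₃ U hU) }
      isStableUnderRetracts :=
        ⟨fun r hY U hU => U.carrier.prop_of_retract r (hY U hU)⟩ }

theorem mem_sInf {S : Set (Thick C)} {X : C} :
    (sInf S).carrier X ↔ ∀ U ∈ S, U.carrier X := Iff.rfl

theorem isGLB_sInf (S : Set (Thick C)) : IsGLB S (sInf S) :=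
  ⟨fun _ hU _ hX => hX _ hU, fun _ hV X hX _ hU => hV hU X hX⟩

/-- The complete lattice of thick subcategories: meets are intersections, and the join of
a set of thick subcategories is the smallest thick subcategory containing all of them. -/
instance : CompleteLattice (Thick C) :=
  { completeLatticeOfInf (Thick C) isGLB_sInf with
    inf := fun U V =>
      { carrier := U.carrier ⊓ V.carrier
        isTriangulated := inferInstance
        isStableUnderRetracts := ⟨fun r h =>
          ⟨U.carrier.prop_of_retract r h.1, V.carrier.prop_of_retract r h.2⟩⟩ }
    inf_le_left := fun _ _ _ h => h.1
    inf_le_right := fun _ _ _ h => h.2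
    le_inf := fun _ _ _ h₁ h₂ X hX => ⟨h₁ X hX, h₂ X hX⟩ }

theorem mem_inf {U V : Thick C} {X : C} :
    (U ⊓ V).carrier X ↔ U.carrier X ∧ V.carrier X := Iff.rfl

/-- Two thick subcategories commute if every morphism between an object of one and an object
of the other (in either direction) factors through an object of their intersection. -/
def Commute (U V : Thick C) : Prop :=
  (∀ ⦃X Y : C⦄ (f : X ⟶ Y), U.carrier X → V.carrier Y →
    ∃ (Z : C) (a : X ⟶ Z) (b : Z ⟶ Y), (U ⊓ V).carrier Z ∧ a ≫ b = f) ∧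
  (∀ ⦃X Y : C⦄ (f : X ⟶ Y), V.carrier X → U.carrier Y →
    ∃ (Z : C) (a : X ⟶ Z) (b : Z ⟶ Y), (U ⊓ V).carrier Z ∧ a ≫ b = f)

/-- The centre `Z(T)` of a set `T` of thick subcategories. -/
def centre (T : Set (Thick C)) : Set (Thick C) :=
  {U | U ∈ T ∧ ∀ V ∈ T, Commute U V}

end Thick

/-! ### Localisation functors and Mayer–Vietoris sequences -/

variable (C) in
/-- Functors from `Cᵒᵖ` to abelian groups. The abelian groups live in a universe with respect
to which `C` is a small category. -/
abbrev AbPresheaf : Type _ := Cᵒᵖ ⥤ AddCommGrpCat.{max u v}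

/-- Exactness of `F ⟶ G ⟶ H`, tested on each object. -/
def IsExact {F G H : AbPresheaf C} (f : F ⟶ G) (g : G ⟶ H) : Prop :=
  ∀ X : Cᵒᵖ, Function.Exact (f.app X) (g.app X)

variable (C) in
/-- A functor `Cᵒᵖ ⥤ Ab` is cohomological if it takes distinguished triangles to exact
sequences. (Such a functor is automatically additive.) -/
def cohomological : ObjectProperty (AbPresheaf C) := fun F =>
  ∀ T ∈ distTriang C, Function.Exact (F.map T.mor₂.op) (F.map T.mor₁.op)

variable (C) in
/-- The category of cohomological functors. -/
abbrev Coh : Type _ := (cohomological C).FullSubcategory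

variable (C) in
/-- The power `Σⁿ` of the suspension of functors, `Σⁿ F = F ∘ Σ⁻ⁿ`. -/
def susp (n : ℤ) : AbPresheaf C ⥤ AbPresheaf C :=
  (Functor.whiskeringLeft _ _ _).obj (shiftFunctor C (-n)).op

namespace Thick

/-- The Verdier quotient `C / S`. -/
abbrev Quot (S : Thick C) : Type u := S.carrier.trW.Localization

/-- The quotient functor `q : C ⥤ C / S`. -/
abbrev quotFunctor (S : Thick C) : C ⥤ S.Quot := S.carrier.trW.Q

/-- The localisation functor `L_S = q_* ∘ q^*`, where `q_*` is composition with `q` and its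
left adjoint `q^*` is left Kan extension along `q`. It takes cohomological functors to
cohomological functors; as these form a full subcategory, morphisms between functors `Coh C ⥤ Coh C`
may be described as morphisms between the composites with the inclusion of `Coh C`. -/
def loc (S : Thick C) : AbPresheaf C ⥤ AbPresheaf C :=
  S.quotFunctor.op.lan ⋙ (Functor.whiskeringLeft _ _ _).obj S.quotFunctor.op

/-- The unit `F ⟶ L_S F`. -/
def locUnit (S : Thick C) : 𝟭 (AbPresheaf C) ⟶ S.loc := S.quotFunctor.op.lanUnit

/-- For `S ≤ S'`, the functor `C / S ⥤ C / S'`. -/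
def quotMap {S S' : Thick C} (h : S ≤ S') : S.Quot ⥤ S'.Quot :=
  Localization.lift S'.quotFunctor
    (fun _ _ f hf => Localization.inverts S'.quotFunctor S'.carrier.trW f
      (ObjectProperty.trW_monotone h f hf)) S.quotFunctor

/-- The functor `C ⥤ C / S'` factors through `C ⥤ C / S`. -/
def quotMapFac {S S' : Thick C} (h : S ≤ S') :
    S.quotFunctor ⋙ quotMap h ≅ S'.quotFunctor :=
  Localization.fac _ _ _

/-- The functor `L_S' F = q'_* q'^* F`, written as restriction along `C ⥤ C / S ⥤ C / S'`. -/
def locIso {S S' : Thick C} (h : S ≤ S') (F : AbPresheaf C) :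
    S'.loc.obj F ≅ S.quotFunctor.op ⋙ (quotMap h).op ⋙ S'.quotFunctor.op.lan.obj F :=
  Functor.isoWhiskerRight (NatIso.op (quotMapFac h)) (S'.quotFunctor.op.lan.obj F)

/-- The canonical morphism `L_S F ⟶ L_S' F` induced by an inclusion `S ≤ S'`, given by the
universal property of the left Kan extension. -/
def locMapApp {S S' : Thick C} (h : S ≤ S') (F : AbPresheaf C) : S.loc.obj F ⟶ S'.loc.obj F :=
  Functor.whiskerLeft S.quotFunctor.op
    ((S.quotFunctor.op.lan.obj F).descOfIsLeftKanExtension (S.quotFunctor.op.lanUnit.app F)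
      ((quotMap h).op ⋙ S'.quotFunctor.op.lan.obj F) (S'.locUnit.app F ≫ (locIso h F).hom)) ≫
  (locIso h F).inv

theorem locUnit_locMapApp {S S' : Thick C} (h : S ≤ S') (F : AbPresheaf C) :
    S.locUnit.app F ≫ locMapApp h F = S'.locUnit.app F := by
  have e := (S.quotFunctor.op.lan.obj F).descOfIsLeftKanExtension_fac
    (S.quotFunctor.op.lanUnit.app F) ((quotMap h).op ⋙ S'.quotFunctor.op.lan.obj F)
    (S'.locUnit.app F ≫ (locIso h F).hom)
  exact (Category.assoc _ _ _).symm.trans <| (congrArg (· ≫ (locIso h F).inv) e).trans <|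
    (Category.assoc _ _ _).trans <| by rw [Iso.hom_inv_id]; exact Category.comp_id _

/-- Restriction along `C ⥤ C / S` is full on presheaves. -/
theorem exists_whiskerLeft (S : Thick C) {A B : S.Quotᵒᵖ ⥤ AddCommGrpCat.{max u v}}
    (φ : S.quotFunctor.op ⋙ A ⟶ S.quotFunctor.op ⋙ B) :
    ∃ ψ : A ⟶ B, Functor.whiskerLeft S.quotFunctor.op ψ = φ := by
  let E := Localization.whiskeringLeftFunctor S.quotFunctor.op S.carrier.trW.op
    AddCommGrpCat.{max u v}
  obtain ⟨ψ, hψ⟩ := E.map_surjective (X := A) (Y := B) (ObjectProperty.homMk φ)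
  exact ⟨ψ, congrArg (fun t => t.hom) hψ⟩

/-- A morphism out of `L_S F` to some `L_S' G` with `S ≤ S'` is determined by its composite
with the unit `F ⟶ L_S F`; in particular the canonical morphism `L_S F ⟶ L_S' F` is the only
one that is compatible with the units. -/
theorem loc_hom_ext {S S' : Thick C} (h : S ≤ S') {F G : AbPresheaf C}
    {φ ψ : S.loc.obj F ⟶ S'.loc.obj G}
    (e : S.locUnit.app F ≫ φ = S.locUnit.app F ≫ ψ) : φ = ψ := by
  let i := locIso h G
  obtain ⟨φ', hφ⟩ := S.exists_whiskerLeft (A := S.quotFunctor.op.lan.obj F)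
    (B := (quotMap h).op ⋙ S'.quotFunctor.op.lan.obj G) (φ ≫ i.hom)
  obtain ⟨ψ', hψ⟩ := S.exists_whiskerLeft (A := S.quotFunctor.op.lan.obj F)
    (B := (quotMap h).op ⋙ S'.quotFunctor.op.lan.obj G) (ψ ≫ i.hom)
  have : φ' = ψ' := by
    apply Functor.hom_ext_of_isLeftKanExtension _ (S.quotFunctor.op.lanUnit.app F)
    rw [hφ, hψ]
    exact (Category.assoc _ _ _).symm.trans ((congrArg (· ≫ i.hom) e).trans (Category.assoc _ _ _))
  rw [← cancel_mono i.hom]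
  exact hφ.symm.trans ((congrArg _ this).trans hψ)

/-- The canonical morphism `L_S ⟶ L_S'` induced by an inclusion `S ≤ S'`. -/
def locMap {S S' : Thick C} (h : S ≤ S') : S.loc ⟶ S'.loc where
  app F := locMapApp h F
  naturality F G f := loc_hom_ext h <| by
    have e₁ := S.locUnit.naturality f
    have e₂ := S'.locUnit.naturality f
    dsimp at e₁ e₂
    rw [← reassoc_of% e₁, locUnit_locMapApp, reassoc_of% (locUnit_locMapApp h F), e₂]

theorem locUnit_locMap {S S' : Thick C} (h : S ≤ S') : S.locUnit ≫ locMap h = S'.locUnit := by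
  ext F : 2
  exact locUnit_locMapApp h F

end Thick

open Thick

/-- The first map of the Mayer–Vietoris sequence, induced by the inclusions of `U ⊓ V` into
`U` and `V`. -/
def mvFst (U V : Thick C) : (U ⊓ V).loc ⟶ U.loc ⊞ V.loc :=
  biprod.lift (locMap inf_le_left) (locMap inf_le_right)

/-- The second map of the Mayer–Vietoris sequence, the difference of the maps induced by the
inclusions of `U` and `V` into `U ⊔ V`. -/
def mvSnd (U V : Thick C) : U.loc ⊞ V.loc ⟶ (U ⊔ V).loc :=
  biprod.desc (locMap le_sup_left) (-locMap le_sup_right)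

/-- A Mayer–Vietoris sequence for `U` and `V`: a natural transformation
`δ : L_{U ⊔ V} ⟶ Σ L_{U ⊓ V}` of functors on `Coh C` such that the long sequence
`⋯ ⟶ Σⁿ L_{U ⊓ V} ⟶ Σⁿ L_U ⊞ Σⁿ L_V ⟶ Σⁿ L_{U ⊔ V} ⟶ Σⁿ⁺¹ L_{U ⊓ V} ⟶ ⋯` is exact. -/
structure MayerVietoris (U V : Thick C) where
  /-- The connecting morphism. -/
  δ : (cohomological C).ι ⋙ (U ⊔ V).loc ⟶ (cohomological C).ι ⋙ (U ⊓ V).loc ⋙ susp C 1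
  exact_mid : ∀ (n : ℤ) (F : Coh C),
    IsExact ((susp C n).map ((mvFst U V).app F.obj)) ((susp C n).map ((mvSnd U V).app F.obj))
  exact_sup : ∀ (n : ℤ) (F : Coh C),
    IsExact ((susp C n).map ((mvSnd U V).app F.obj)) ((susp C n).map (δ.app F))
  exact_inf : ∀ (n : ℤ) (F : Coh C),
    IsExact ((susp C n).map (δ.app F))
      ((susp C n).map ((susp C 1).map ((mvFst U V).app F.obj)))

/-! ### Spatial frames and central support -/

/-- A frame `L` is spatial if `a ↦ {p | p a}` is an isomorphism from `L` onto the frame of open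
subsets of the space of points of `L`, a point being a frame morphism to `{0, 1}`. -/
def IsSpatial (L : Type*) [Order.Frame L] : Prop :=
  ∃ e : L ≃o TopologicalSpace.Opens (Locale.PT L), ∀ a, (e a : Set (Locale.PT L)) = {p | p a}

/-- The centre `Z(T)` as a type, the order on it is introduced separately. -/
def Centre (T : Set (Thick C)) : Type u := {U : Thick C // U ∈ centre T}

section

variable (T : Set (Thick C)) [Order.Frame (Centre T)]

/-- The space of points of the frame `Z(T)`. -/
abbrev SpcCent : Type u := Locale.PT (Centre T)

variable {T}

/-- The prime element of `Z(T)` that corresponds to a point `p`: the join of all `U` in `Z(T)`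
with `p U = 0`. -/
def SpcCent.prime (p : SpcCent T) : Thick C := (sSup {U : Centre T | ¬ p U}).1

variable (T)

/-- The central support of an object: the primes that do not contain it. -/
def suppCent (X : C) : Set (SpcCent T) := {p | ¬ (SpcCent.prime p).carrier X}

/-- The central support of a class of objects. -/
def suppCentClass (𝒳 : ObjectProperty C) : Set (SpcCent T) :=
  ⋃ (X : C) (_ : 𝒳 X), suppCent T X

end

end ThickCentre

end

/-! Closure and distributivity rest on one observation: for `N ≤ V` the objects all of whose
morphisms to `V` factor through `N` form a thick subcategory (`orthLeft`, dually `orthRight`). Hence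
commutation with `W` passes from a family to its join, and, applied to identity morphisms with `N`
the join of the `U ⊓ V`, the same fact gives the frame law `inf_sSup_le`. For binary meets one
factors twice, using that `U ⊓ W` again lies in `T`.

The centre is spatial because membership of a single object is a finitary condition: the union of a
nonempty chain is thick. Zorn's lemma gives an element of the centre maximal among those not
containing `X`, and distributivity makes it prime. So the points separate elements, and the central
support of `U` is the open set of points `p` with `p U`. Sobriety holds for the space of points of
any complete lattice.

For Mayer–Vietoris, calculus of fractions turns the Kan extension into a filtered colimit: an
element of `L_S F` at `X` is represented by an element of `F` over some `Z ⟶ X` with cone in `S`.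
The heart is excision (`Commute.excisive`): if `U` and `V` commute, then `L_{U ⊓ V} F ⟶ L_U F ⊞ L_V
F` is bijective at every `W` in `U ⊔ V`. For `W` in `U` the summand `L_U F` vanishes and the
factorisations identify `L_{U ⊓ V} F` with `L_V F`; likewise for `V`; a five lemma extends this to
the join. A class over `X` lifts to `L_{U ⊓ V} F` over some `Q ⟶ X` with cone `W` in `U ⊔ V`.
Restricting the lift to `W⟦-1⟧`, taking its `U`-part by excision and restricting to `X⟦-1⟧` defines
the connecting map; exactness is a chase through the long exact sequences of such triangles. -/

namespace ThickCentre

variable {C : Type u} [Category.{v} C] [HasZeroObject C] [HasShift C ℤ] [Preadditive C]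
  [∀ n : ℤ, (shiftFunctor C n).Additive] [Pretriangulated C]

/-! ### Lifting and extension in distinguished triangles. -/

section Triangles

open Pretriangulated

variable {X Y Z : C} {f : X ⟶ Y} {g : Y ⟶ Z} {h : Z ⟶ X⟦(1 : ℤ)⟧}

theorem comp_zero₁₂ (H : Triangle.mk f g h ∈ distTriang C) : f ≫ g = 0 :=
  comp_distTriang_mor_zero₁₂ _ H

theorem comp_zero₂₃ (H : Triangle.mk f g h ∈ distTriang C) : g ≫ h = 0 :=
  comp_distTriang_mor_zero₂₃ _ H

theorem comp_zero₃₁ (H : Triangle.mk f g h ∈ distTriang C) : h ≫ f⟦(1 : ℤ)⟧' = 0 :=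
  comp_distTriang_mor_zero₃₁ _ H

theorem exists_desc (H : Triangle.mk f g h ∈ distTriang C) {A : C} (k : Y ⟶ A)
    (hk : f ≫ k = 0) : ∃ l : Z ⟶ A, k = g ≫ l :=
  Triangle.yoneda_exact₂ _ H k hk

theorem exists_lift (H : Triangle.mk f g h ∈ distTriang C) {A : C} (k : A ⟶ Y)
    (hk : k ≫ g = 0) : ∃ l : A ⟶ X, k = l ≫ f :=
  Triangle.coyoneda_exact₂ _ H k hk

theorem exists_lift₃ (H : Triangle.mk f g h ∈ distTriang C) {A : C} (k : A ⟶ Z)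
    (hk : k ≫ h = 0) : ∃ l : A ⟶ Y, k = l ≫ g :=
  Triangle.coyoneda_exact₃ _ H k hk

variable {X' Y' Z' : C} {f' : X' ⟶ Y'} {g' : Y' ⟶ Z'} {h' : Z' ⟶ X'⟦(1 : ℤ)⟧}

theorem exists_map₂ (H : Triangle.mk f g h ∈ distTriang C)
    (H' : Triangle.mk f' g' h' ∈ distTriang C) (a : X ⟶ X') (c : Z ⟶ Z')
    (w : h ≫ a⟦(1 : ℤ)⟧' = c ≫ h') :
    ∃ b : Y ⟶ Y', f ≫ b = a ≫ f' ∧ g ≫ c = b ≫ g' :=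
  complete_distinguished_triangle_morphism₂ _ _ H H' a c w

theorem exists_map₃ (H : Triangle.mk f g h ∈ distTriang C)
    (H' : Triangle.mk f' g' h' ∈ distTriang C) (a : X ⟶ X') (b : Y ⟶ Y')
    (w : f ≫ b = a ≫ f') :
    ∃ c : Z ⟶ Z', g ≫ c = b ≫ g' ∧ h ≫ a⟦(1 : ℤ)⟧' = c ≫ h' :=
  complete_distinguished_triangle_morphism _ _ H H' a b w

theorem exists_map₁ (H : Triangle.mk f g h ∈ distTriang C)
    (H' : Triangle.mk f' g' h' ∈ distTriang C) (b : Y ⟶ Y') (c : Z ⟶ Z')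
    (w : g ≫ c = b ≫ g') :
    ∃ a : X ⟶ X', f ≫ b = a ≫ f' ∧ h ≫ a⟦(1 : ℤ)⟧' = c ≫ h' :=
  complete_distinguished_triangle_morphism₁ _ _ H H' b c w

theorem exists_extend (H : Triangle.mk f g h ∈ distTriang C) {A : C} (k : X ⟶ A)
    (hk : h ≫ k⟦(1 : ℤ)⟧' = 0) : ∃ l : Y ⟶ A, k = f ≫ l := by
  obtain ⟨l, hl, -⟩ := exists_map₂ H (contractible_distinguished A) k 0
    (hk.trans zero_comp.symm)
  exact ⟨l, (Category.comp_id k).symm.trans hl.symm⟩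

end Triangles

/-! ### Commuting thick subcategories and closure properties of the centre. -/

namespace Thick

theorem ext₁ (N : Thick C) {X Y Z : C} {f : X ⟶ Y} {g : Y ⟶ Z} {h : Z ⟶ X⟦(1 : ℤ)⟧}
    (H : Pretriangulated.Triangle.mk f g h ∈ distTriang C) (hY : N.carrier Y)
    (hZ : N.carrier Z) : N.carrier X :=
  N.carrier.ext_of_isTriangulatedClosed₁ _ H hY hZ

theorem ext₂ (N : Thick C) {X Y Z : C} {f : X ⟶ Y} {g : Y ⟶ Z} {h : Z ⟶ X⟦(1 : ℤ)⟧}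
    (H : Pretriangulated.Triangle.mk f g h ∈ distTriang C) (hX : N.carrier X)
    (hZ : N.carrier Z) : N.carrier Y :=
  N.carrier.ext_of_isTriangulatedClosed₂ _ H hX hZ

theorem ext₃ (N : Thick C) {X Y Z : C} {f : X ⟶ Y} {g : Y ⟶ Z} {h : Z ⟶ X⟦(1 : ℤ)⟧}
    (H : Pretriangulated.Triangle.mk f g h ∈ distTriang C) (hX : N.carrier X)
    (hY : N.carrier Y) : N.carrier Z :=
  N.carrier.ext_of_isTriangulatedClosed₃ _ H hX hY

/-- The morphism `f` factors through an object of `N`. -/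
def Factors (N : Thick C) {X Y : C} (f : X ⟶ Y) : Prop :=
  ∃ (Z : C) (a : X ⟶ Z) (b : Z ⟶ Y), N.carrier Z ∧ a ≫ b = f

namespace Factors

variable {N : Thick C} {X Y : C}

theorem of_left (hX : N.carrier X) (f : X ⟶ Y) : N.Factors f :=
  ⟨X, 𝟙 X, f, hX, Category.id_comp f⟩

theorem of_right (hY : N.carrier Y) (f : X ⟶ Y) : N.Factors f :=
  ⟨Y, f, 𝟙 Y, hY, Category.comp_id f⟩

theorem precomp {f : X ⟶ Y} (h : N.Factors f) {X' : C} (g : X' ⟶ X) : N.Factors (g ≫ f) := by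
  obtain ⟨Z, a, b, hZ, rfl⟩ := h
  exact ⟨Z, g ≫ a, b, hZ, Category.assoc _ _ _⟩

theorem postcomp {f : X ⟶ Y} (h : N.Factors f) {Y' : C} (g : Y ⟶ Y') : N.Factors (f ≫ g) := by
  obtain ⟨Z, a, b, hZ, rfl⟩ := h
  exact ⟨Z, a, b ≫ g, hZ, (Category.assoc _ _ _).symm⟩

theorem mono {N' : Thick C} (hN : N ≤ N') {f : X ⟶ Y} (h : N.Factors f) : N'.Factors f := by
  obtain ⟨Z, a, b, hZ, e⟩ := h
  exact ⟨Z, a, b, hN Z hZ, e⟩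

theorem mem_of_id (h : N.Factors (𝟙 X)) : N.carrier X := by
  obtain ⟨Z, a, b, hZ, e⟩ := h
  exact N.carrier.prop_of_retract ⟨a, b, e⟩ hZ

theorem add {f g : X ⟶ Y} (hf : N.Factors f) (hg : N.Factors g) : N.Factors (f + g) := by
  obtain ⟨Z, a, b, hZ, rfl⟩ := hf
  obtain ⟨Z', a', b', hZ', rfl⟩ := hg
  refine ⟨Z ⊞ Z', biprod.lift a a', biprod.desc b b', ?_, by simp⟩
  exact N.carrier.ext_of_isTriangulatedClosed₂ _ (Pretriangulated.binaryBiproductTriangle_distinguished Z Z')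
    hZ hZ'

theorem of_shift {f : X ⟶ Y} (n : ℤ) (h : N.Factors (f⟦n⟧')) : N.Factors f := by
  obtain ⟨Z, a, b, hZ, e⟩ := h
  let i : (Z⟦-n⟧)⟦n⟧ ≅ Z := (shiftFunctorCompIsoId C (-n) n (neg_add_cancel n)).app Z
  refine ⟨Z⟦-n⟧, (shiftFunctor C n).preimage (a ≫ i.inv),
    (shiftFunctor C n).preimage (i.hom ≫ b), N.carrier.le_shift _ _ hZ, ?_⟩
  apply (shiftFunctor C n).map_injective
  simp [e]

end Factors

/-- The objects `X` such that every morphism from `X` to an object of `V` factors through `N`. -/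
def orthLeft (N V : Thick C) (hN : N ≤ V) : Thick C where
  carrier X := ∀ ⦃Y : C⦄ (f : X ⟶ Y), V.carrier Y → N.Factors f
  isStableUnderRetracts := ⟨fun {X X'} r h Y f hY => by
    simpa using (h (r.r ≫ f) hY).precomp r.i⟩
  isTriangulated :=
    { exists_zero := ⟨0, isZero_zero C, fun Y f _ => .of_left N.carrier.prop_zero f⟩
      isStableUnderShiftBy := fun n => ⟨fun X hX Y f hY => by
        refine .of_shift (-n) ?_
        let i : X ≅ (X⟦n⟧)⟦-n⟧ :=
          ((shiftFunctorCompIsoId C n (-n) (add_neg_cancel n)).app X).symm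
        simpa using (hX (i.hom ≫ f⟦-n⟧') (V.carrier.le_shift _ _ hY)).precomp i.inv⟩
      ext₂' := fun T hT h₁ h₃ => ObjectProperty.le_isoClosure _ _ fun Y f hY => by
        obtain ⟨Z, a, b, hZ, e⟩ := h₁ (T.mor₁ ≫ f) hY
        obtain ⟨Y', c, d, hT'⟩ := Pretriangulated.distinguished_cocone_triangle b
        obtain ⟨g, hg⟩ := Pretriangulated.Triangle.yoneda_exact₂ T hT (f ≫ c) (by
          rw [← Category.assoc, ← e, Category.assoc, comp_zero₁₂ hT', comp_zero])
        obtain ⟨Z', a', b', hZ', rfl⟩ := h₃ g (V.ext₃ hT' (hN _ hZ) hY)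
        -- `P` is an extension of `Z'` by `Z` mapping to `Y` compatibly with `b'`. Modulo a morphism
        -- through `P`, `f` vanishes in the cone `Y'` of `b`, so the remainder factors through `Z`.
        obtain ⟨P, p₁, p₂, hP⟩ := Pretriangulated.distinguished_cocone_triangle₂ (b' ≫ d)
        have hPN : N.carrier P := N.ext₂ hP hZ hZ'
        obtain ⟨k, -, hk⟩ := exists_map₂ hP hT' (𝟙 Z) b' (by simp)
        obtain ⟨l, hl⟩ := exists_lift₃ hP (T.mor₂ ≫ a') (by
          have := congrArg (· ≫ d) hg
          simp only [Category.assoc, comp_zero₂₃ hT', comp_zero] at this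
          simpa using this.symm)
        obtain ⟨m, hm⟩ := exists_lift hT' (f - l ≫ k) (by
          rw [Preadditive.sub_comp, Category.assoc, ← hk, ← Category.assoc, ← hl, hg,
            Category.assoc, sub_self])
        have : f = l ≫ k + m ≫ b := by rw [← sub_eq_iff_eq_add']; exact hm
        rw [this]
        exact ((Factors.of_left hPN k).precomp l).add ((Factors.of_left hZ b).precomp m) }

/-- The objects `Y` such that every morphism from an object of `U` to `Y` factors through `N`. -/
def orthRight (N U : Thick C) (hN : N ≤ U) : Thick C where
  carrier Y := ∀ ⦃X : C⦄ (f : X ⟶ Y), U.carrier X → N.Factors f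
  isStableUnderRetracts := ⟨fun {Y Y'} r h X f hX => by
    simpa using (h (f ≫ r.i) hX).postcomp r.r⟩
  isTriangulated :=
    { exists_zero := ⟨0, isZero_zero C, fun X f _ => .of_right N.carrier.prop_zero f⟩
      isStableUnderShiftBy := fun n => ⟨fun Y hY X f hX => by
        refine .of_shift (-n) ?_
        let i : (Y⟦n⟧)⟦-n⟧ ≅ Y := (shiftFunctorCompIsoId C n (-n) (add_neg_cancel n)).app Y
        simpa using (hY (f⟦-n⟧' ≫ i.hom) (U.carrier.le_shift _ _ hX)).postcomp i.inv⟩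
      ext₂' := fun T hT h₁ h₃ => ObjectProperty.le_isoClosure _ _ fun X f hX => by
        obtain ⟨Z, a, b, hZ, e⟩ := h₃ (f ≫ T.mor₂) hX
        obtain ⟨X', i, d, hT'⟩ := Pretriangulated.distinguished_cocone_triangle₁ a
        obtain ⟨g, hg⟩ := Pretriangulated.Triangle.coyoneda_exact₂ T hT (i ≫ f) (by
          rw [Category.assoc, ← e, ← Category.assoc, comp_zero₁₂ hT', zero_comp])
        obtain ⟨Z', a', b', hZ', rfl⟩ := h₁ g (U.ext₁ hT' hX (hN _ hZ))
        -- Dually to `orthLeft`, `P` is an extension of `Z` by `Z'`; subtracting a morphism through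
        -- `P` leaves one that vanishes on the fibre `X'` of `a` and so factors through `Z`.
        obtain ⟨P, p₁, p₂, hP⟩ :=
          Pretriangulated.distinguished_cocone_triangle₂ (d ≫ a'⟦(1 : ℤ)⟧')
        have hPN : N.carrier P := N.ext₂ hP hZ' hZ
        obtain ⟨k, hk, -⟩ := exists_map₂ hT' hP a' (𝟙 Z) (by simp)
        obtain ⟨l, hl⟩ := exists_extend hP (b' ≫ T.mor₁) (by
          have := congrArg (fun t => d ≫ t⟦(1 : ℤ)⟧') hg
          simp only [Functor.map_comp, Category.assoc] at this
          simp only [Functor.map_comp, Category.assoc]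
          rw [← this, ← Category.assoc, comp_zero₃₁ hT', zero_comp])
        obtain ⟨m, hm⟩ := exists_desc hT' (f - k ≫ l) (by
          rw [Preadditive.comp_sub, ← Category.assoc, hk, Category.assoc, ← hl, hg,
            Category.assoc, sub_self])
        have : f = k ≫ l + a ≫ m := by rw [← sub_eq_iff_eq_add']; exact hm
        rw [this]
        exact ((Factors.of_left hPN l).precomp k).add ((Factors.of_right hZ a).postcomp m) }

theorem Commute.symm {U V : Thick C} (h : Commute U V) : Commute V U := by
  rw [Commute, inf_comm]
  exact ⟨h.2, h.1⟩

theorem Commute.left_factors {U V : Thick C} (h : Commute U V) {X Y : C} (f : X ⟶ Y)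
    (hX : U.carrier X) (hY : V.carrier Y) : (U ⊓ V).Factors f := h.1 f hX hY

theorem Commute.right_factors {U V : Thick C} (h : Commute U V) {X Y : C} (f : X ⟶ Y)
    (hX : V.carrier X) (hY : U.carrier Y) : (U ⊓ V).Factors f := h.2 f hX hY

theorem Commute.of_le {U V : Thick C} (h : U ≤ V) : Commute U V := by
  rw [Commute, inf_eq_left.2 h]
  exact ⟨fun X Y f hX _ => Factors.of_left hX f, fun X Y f _ hY => Factors.of_right hY f⟩

/-- Factor first through `U ⊓ W`, then factor the half that touches `V` through `V ⊓ (U ⊓ W)`. -/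
theorem Commute.inf {U V W : Thick C} (hU : Commute U W) (hV : Commute V (U ⊓ W)) :
    Commute (U ⊓ V) W := by
  have hle : V ⊓ (U ⊓ W) ≤ (U ⊓ V) ⊓ W :=
    le_inf (le_inf (inf_le_right.trans inf_le_left) inf_le_left) (inf_le_right.trans inf_le_right)
  constructor
  · rintro X Y f hX hY
    obtain ⟨Z, a, b, hZ, rfl⟩ := hU.left_factors f hX.1 hY
    exact ((hV.left_factors a hX.2 hZ).mono hle).postcomp b
  · rintro X Y f hX hY
    obtain ⟨Z, a, b, hZ, rfl⟩ := hU.right_factors f hX hY.1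
    exact ((hV.right_factors b hZ hY.2).mono hle).precomp a

theorem Commute.sSup_left {S : Set (Thick C)} {W : Thick C} (h : ∀ U ∈ S, Commute U W) :
    Commute (sSup S) W := by
  constructor
  · intro X Y f hX hY
    have : sSup S ≤ orthLeft (sSup S ⊓ W) W inf_le_right := sSup_le fun U hU X hX Y f hY =>
      ((h U hU).left_factors f hX hY).mono (inf_le_inf_right _ (le_sSup hU))
    exact this X hX f hY
  · intro X Y f hX hY
    have : sSup S ≤ orthRight (sSup S ⊓ W) W inf_le_right := sSup_le fun U hU Y hY X f hX =>
      ((h U hU).right_factors f hX hY).mono (inf_le_inf_right _ (le_sSup hU))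
    exact this Y hY f hX

/-- The objects receiving from `U` only morphisms that factor through the right-hand side form a
thick subcategory containing `S`. An object of the left-hand side is then a retract of an object of
the right-hand side, through its identity. -/
theorem inf_sSup_le {S : Set (Thick C)} {U : Thick C} (h : ∀ V ∈ S, Commute U V) :
    U ⊓ sSup S ≤ ⨆ V ∈ S, U ⊓ V := by
  have hN : ⨆ V ∈ S, U ⊓ V ≤ U := iSup₂_le fun V _ => inf_le_left
  have : sSup S ≤ orthRight (⨆ V ∈ S, U ⊓ V) U hN := sSup_le fun V hV Y hY X f hX =>
    ((h V hV).left_factors f hX hY).mono (le_iSup₂_of_le V hV le_rfl)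
  intro X hX
  exact (this X hX.2 (𝟙 X) hX.1).mem_of_id

/-- The union of a nonempty chain of thick subcategories is thick. -/
theorem mem_sSup_of_isChain {S : Set (Thick C)} (hS : IsChain (· ≤ ·) S) (hne : S.Nonempty)
    {X : C} : (sSup S).carrier X ↔ ∃ U ∈ S, U.carrier X := by
  refine ⟨fun hX => ?_, fun ⟨U, hU, hX⟩ => le_sSup hU X hX⟩
  let V : Thick C :=
    { carrier := fun X => ∃ U ∈ S, U.carrier X
      isTriangulated :=
        { exists_zero := ⟨0, isZero_zero C, hne.some, hne.some_mem, hne.some.carrier.prop_zero⟩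
          isStableUnderShiftBy := fun n =>
            ⟨fun X ⟨U, hU, hX⟩ => ⟨U, hU, U.carrier.le_shift n X hX⟩⟩
          ext₂' := fun T hT ⟨U₁, hU₁, h₁⟩ ⟨U₃, hU₃, h₃⟩ => by
            refine ObjectProperty.le_isoClosure _ _ ?_
            rcases hS.total hU₁ hU₃ with h | h
            · exact ⟨U₃, hU₃, U₃.carrier.ext_of_isTriangulatedClosed₂ T hT (h _ h₁) h₃⟩
            · exact ⟨U₁, hU₁, U₁.carrier.ext_of_isTriangulatedClosed₂ T hT h₁ (h _ h₃)⟩ }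
      isStableUnderRetracts :=
        ⟨fun r ⟨U, hU, hX⟩ => ⟨U, hU, U.carrier.prop_of_retract r hX⟩⟩ }
  have : sSup S ≤ V := sSup_le fun U hU X hX => ⟨U, hU, hX⟩
  exact this X hX

section Centre

variable {T : Set (Thick C)}

theorem isSublattice_centre (hT : IsSublattice T) : IsSublattice (centre T) where
  supClosed := fun U hU V hV => ⟨hT.supClosed hU.1 hV.1, fun W hW => by
    rw [← sSup_pair]
    refine Commute.sSup_left ?_
    rintro _ (rfl | rfl)
    exacts [hU.2 W hW, hV.2 W hW]⟩
  infClosed := fun U hU V hV => ⟨hT.infClosed hU.1 hV.1, fun W hW =>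
    (hU.2 W hW).inf (hV.2 _ (hT.infClosed hU.1 hW))⟩

theorem sSup_mem_centre (hT : ∀ S ⊆ T, sSup S ∈ T) {S : Set (Thick C)} (hS : S ⊆ centre T) :
    sSup S ∈ centre T :=
  ⟨hT S fun _ hU => (hS hU).1, fun W hW => Commute.sSup_left fun _ hU => (hS hU).2 W hW⟩

theorem top_mem_centre (h : ⊤ ∈ T) : ⊤ ∈ centre T :=
  ⟨h, fun _ _ => (Commute.of_le le_top).symm⟩

end Centre

end Thick

end ThickCentre

/-! ### Left Kan extension along a localisation, computed by fractions. -/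

namespace ThickCentre

variable {C : Type u} [Category.{v} C]

/-- Restriction of elements of a presheaf along a morphism. -/
def res (F : AbPresheaf C) {X Y : C} (f : X ⟶ Y) : F.obj (op Y) →+ F.obj (op X) :=
  (F.map f.op).hom

/-- The action of a morphism of presheaves on elements. -/
def ev {F G : AbPresheaf C} (φ : F ⟶ G) (X : C) : F.obj (op X) →+ G.obj (op X) :=
  (φ.app (op X)).hom

theorem res_comp (F : AbPresheaf C) {X Y Z : C} (f : X ⟶ Y) (g : Y ⟶ Z) (x : F.obj (op Z)) :
    res F (f ≫ g) x = res F f (res F g x) := by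
  simp [res]

theorem res_id (F : AbPresheaf C) {X : C} (x : F.obj (op X)) : res F (𝟙 X) x = x := by
  simp [res]

theorem ev_res {F G : AbPresheaf C} (φ : F ⟶ G) {X Y : C} (f : X ⟶ Y) (x : F.obj (op Y)) :
    ev φ X (res F f x) = res G f (ev φ Y x) :=
  ConcreteCategory.congr_hom (φ.naturality f.op) x

theorem ev_comp {F G H : AbPresheaf C} (φ : F ⟶ G) (ψ : G ⟶ H) (X : C) (x : F.obj (op X)) :
    ev (φ ≫ ψ) X x = ev ψ X (ev φ X x) := by
  simp [ev]

theorem ev_add {F G : AbPresheaf C} (φ ψ : F ⟶ G) (X : C) (x : F.obj (op X)) :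
    ev (φ + ψ) X x = ev φ X x + ev ψ X x := by
  simp [ev]

theorem ev_sub {F G : AbPresheaf C} (φ ψ : F ⟶ G) (X : C) (x : F.obj (op X)) :
    ev (φ - ψ) X x = ev φ X x - ev ψ X x := by
  simp [ev]

theorem res_bijective (F : AbPresheaf C) {X Y : C} (f : X ⟶ Y) [IsIso (F.map f.op)] :
    Function.Bijective (res F f) :=
  ConcreteCategory.bijective_of_isIso (F.map f.op)

/-- These universe levels are those of the comma categories indexing the Kan extension. -/
theorem preservesFilteredColimits_forget :
    PreservesFilteredColimitsOfSize.{v, max u v} (forget AddCommGrpCat.{max u v}) :=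
  preservesFilteredColimitsOfSize_shrink.{max u v, max u v, v, max u v} _

section Localization

variable {D : Type u} [Category.{max u v} D] (W : MorphismProperty C)
  [W.HasRightCalculusOfFractions] (L : C ⥤ D) [L.IsLocalization W]

include W in
theorem exists_fraction {X Y : C} (f : L.obj X ⟶ L.obj Y) :
    ∃ (Z : C) (s : Z ⟶ X) (g : Z ⟶ Y), W s ∧ L.map s ≫ f = L.map g := by
  obtain ⟨φ, rfl⟩ := Localization.exists_rightFraction L W f
  exact ⟨_, φ.s, φ.f, φ.hs, φ.map_s_comp_map L _⟩

include W in
/-- The comma categories of a localisation functor with a right calculus of fractions are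
cofiltered. -/
theorem isFiltered_costructuredArrow (X : C) :
    IsFiltered (CostructuredArrow L.op (op (L.obj X))) := by
  have hinv := Localization.inverts L W
  let mk {Y : C} (f : L.obj X ⟶ L.obj Y) : CostructuredArrow L.op (op (L.obj X)) :=
    CostructuredArrow.mk (Y := op Y) f.op
  refine @IsFiltered.mk _ _ (@IsFilteredOrEmpty.mk _ _ ?_ ?_) ⟨mk (𝟙 (L.obj X))⟩
  · intro A B
    obtain ⟨Z₁, s₁, g₁, hs₁, e₁⟩ := exists_fraction W L A.hom.unop
    obtain ⟨Z₂, s₂, g₂, hs₂, e₂⟩ := exists_fraction W L B.hom.unop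
    obtain ⟨χ, e⟩ := MorphismProperty.HasRightCalculusOfFractions.exists_rightFraction
      (W := W) (MorphismProperty.LeftFraction.mk s₁ s₂ hs₂)
    dsimp at e
    have hc : W (χ.s ≫ s₁) := W.comp_mem _ _ χ.hs hs₁
    have := hinv _ hc
    -- Both structure morphisms are fractions, and the Ore square supplies a common denominator; its
    -- formal inverse is the upper bound.
    refine ⟨mk (inv (L.map (χ.s ≫ s₁))), CostructuredArrow.homMk (χ.s ≫ g₁).op ?_,
      CostructuredArrow.homMk (χ.f ≫ g₂).op ?_, trivial⟩
    · apply Quiver.Hom.unop_inj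
      change inv (L.map (χ.s ≫ s₁)) ≫ L.map (χ.s ≫ g₁) = A.hom.unop
      rw [IsIso.inv_comp_eq, L.map_comp, L.map_comp, Category.assoc, e₁]
    · apply Quiver.Hom.unop_inj
      change inv (L.map (χ.s ≫ s₁)) ≫ L.map (χ.f ≫ g₂) = B.hom.unop
      rw [IsIso.inv_comp_eq, e, L.map_comp, L.map_comp, Category.assoc, e₂]
  · intro A B u v
    obtain ⟨Z, s, g, hs, e⟩ := exists_fraction W L B.hom.unop
    have hu : B.hom.unop ≫ L.map u.left.unop = A.hom.unop := congrArg Quiver.Hom.unop (CostructuredArrow.w u)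
    have hv : B.hom.unop ≫ L.map v.left.unop = A.hom.unop := congrArg Quiver.Hom.unop (CostructuredArrow.w v)
    have huv : L.map (g ≫ u.left.unop) = L.map (g ≫ v.left.unop) := by
      rw [L.map_comp, L.map_comp, ← e, Category.assoc, Category.assoc, hu, hv]
    obtain ⟨Z', t, ht, e'⟩ := (MorphismProperty.map_eq_iff_precomp L W _ _).1 huv
    have hc : W (t ≫ s) := W.comp_mem _ _ ht hs
    have := hinv _ hc
    refine ⟨mk (inv (L.map (t ≫ s))), CostructuredArrow.homMk (t ≫ g).op ?_, ?_⟩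
    · apply Quiver.Hom.unop_inj
      change inv (L.map (t ≫ s)) ≫ L.map (t ≫ g) = B.hom.unop
      rw [IsIso.inv_comp_eq, L.map_comp, L.map_comp, Category.assoc, e]
    · apply CostructuredArrow.hom_ext
      apply Quiver.Hom.unop_inj
      change (t ≫ g) ≫ u.left.unop = (t ≫ g) ≫ v.left.unop
      rw [Category.assoc, Category.assoc, e']

variable {W L} (F : AbPresheaf C) {G : Dᵒᵖ ⥤ AddCommGrpCat.{max u v}} (α : F ⟶ L.op ⋙ G)
  [G.IsLeftKanExtension α]

/-- The presheaf `G`, restricted to `C`. -/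
abbrev pull (L : C ⥤ D) (G : Dᵒᵖ ⥤ AddCommGrpCat.{max u v}) : AbPresheaf C := L.op ⋙ G

variable (W) in
include W in
-- The value of `G` is a filtered colimit, so `y` comes from one index; writing its structure
-- morphism as a fraction `s⁻¹g` moves the representative along `g`.
theorem exists_rep_of_isLeftKanExtension {X : C} (y : (pull L G).obj (op X)) :
    ∃ (Z : C) (s : Z ⟶ X) (a : F.obj (op Z)), W s ∧
      res (pull L G) s y = ev (G := pull L G) α Z a := by
  have := isFiltered_costructuredArrow W L X
  have hc := Functor.isPointwiseLeftKanExtensionOfIsLeftKanExtension G α (op (L.obj X))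
  have : PreservesColimitsOfShape (CostructuredArrow L.op (op (L.obj X)))
      (forget AddCommGrpCat.{max u v}) :=
    preservesFilteredColimits_forget.{v, u}.preserves_filtered_colimits _
  obtain ⟨A, b, hb⟩ := Concrete.isColimit_exists_rep _ hc y
  obtain ⟨Z, s, g, hs, e⟩ := exists_fraction W L A.hom.unop
  refine ⟨Z, s, res F g b, hs, ?_⟩
  refine Eq.trans ?_ (ev_res (G := pull L G) α g b).symm
  rw [← hb]
  change (G.map (L.map s).op) (G.map A.hom (α.app A.left b)) = G.map (L.map g).op (α.app A.left b)
  have h : G.map A.hom ≫ G.map (L.map s).op = G.map (L.map g).op := by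
    rw [← G.map_comp, ← e]; rfl
  exact ConcreteCategory.congr_hom h _

variable (W) in
include W in
theorem exists_res_eq_zero_of_isLeftKanExtension {X : C} (a : F.obj (op X))
    (ha : ev (G := pull L G) α X a = 0) :
    ∃ (Z : C) (s : Z ⟶ X), W s ∧ res F s a = 0 := by
  have := isFiltered_costructuredArrow W L X
  have hc := Functor.isPointwiseLeftKanExtensionOfIsLeftKanExtension G α (op (L.obj X))
  have : PreservesColimitsOfShape (CostructuredArrow L.op (op (L.obj X)))
      (forget AddCommGrpCat.{max u v}) :=
    preservesFilteredColimits_forget.{v, u}.preserves_filtered_colimits _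
  let A : CostructuredArrow L.op (op (L.obj X)) := CostructuredArrow.mk (Y := op X) (𝟙 _)
  obtain ⟨B, f, g, hfg⟩ := (Concrete.isColimit_rep_eq_iff_exists _ hc (i := A) (j := A) a 0).1 (by
    rw [map_zero]
    change G.map (𝟙 _) (α.app (op X) a) = 0
    rw [G.map_id]
    exact ha)
  obtain ⟨Z, s, h, hs, e⟩ := exists_fraction W L B.hom.unop
  have hf : B.hom.unop ≫ L.map f.left.unop = 𝟙 _ :=
    congrArg Quiver.Hom.unop (CostructuredArrow.w f)
  -- The element dies along `f`, a section of which in the localisation is the fraction `s⁻¹h`. So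
  -- `h ≫ f` and `s` agree after a further denominator `t`, and `t ≫ s` kills `a`.
  have hs' : L.map (h ≫ f.left.unop) = L.map s := by
    rw [L.map_comp, ← e, Category.assoc, hf, Category.comp_id]
  obtain ⟨Z', t, ht, e'⟩ := (MorphismProperty.map_eq_iff_precomp L W _ _).1 hs'
  refine ⟨Z', t ≫ s, W.comp_mem _ _ ht hs, ?_⟩
  rw [← e', res_comp, res_comp]
  have : res F f.left.unop a = 0 := hfg.trans (map_zero _)
  rw [this, map_zero, map_zero]

end Localization

end ThickCentre

/-! ### Cohomological functors and their localisations. -/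

namespace ThickCentre

variable {C : Type u} [Category.{v} C] [HasZeroObject C] [HasShift C ℤ] [Preadditive C]
  [∀ n : ℤ, (shiftFunctor C n).Additive] [Pretriangulated C]

section Cohomological

open Pretriangulated

variable {F : AbPresheaf C} (hF : cohomological C F)

include hF

theorem exists_res_eq {X Y Z : C} {f : X ⟶ Y} {g : Y ⟶ Z} {h : Z ⟶ X⟦(1 : ℤ)⟧}
    (H : Triangle.mk f g h ∈ distTriang C) {x : F.obj (op Y)} (hx : res F f x = 0) :
    ∃ y : F.obj (op Z), res F g y = x :=
  (hF _ H x).1 hx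

theorem res_res_eq_zero {X Y Z : C} {f : X ⟶ Y} {g : Y ⟶ Z} {h : Z ⟶ X⟦(1 : ℤ)⟧}
    (H : Triangle.mk f g h ∈ distTriang C) (y : F.obj (op Z)) : res F f (res F g y) = 0 :=
  (hF _ H _).2 ⟨y, rfl⟩

theorem eq_zero_of_isZero {X : C} (hX : IsZero X) (x : F.obj (op X)) : x = 0 := by
  have H : Triangle.mk (𝟙 X) (𝟙 X) (0 : X ⟶ X⟦(1 : ℤ)⟧) ∈ distTriang C :=
    isomorphic_distinguished _ (contractible_distinguished X) _
      (Triangle.isoMk _ _ (Iso.refl _) (Iso.refl _) (hX.iso (isZero_zero C))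
        (hX.eq_of_src _ _) (hX.eq_of_src _ _) (hX.eq_of_src _ _))
  simpa [res_id] using res_res_eq_zero hF H x

theorem res_zero {X Y : C} (x : F.obj (op Y)) : res F (0 : X ⟶ Y) x = 0 := by
  have : (0 : X ⟶ Y) = (0 : X ⟶ 0) ≫ (0 : 0 ⟶ Y) := by simp
  rw [this, res_comp, eq_zero_of_isZero hF (isZero_zero C) (res F (0 : 0 ⟶ Y) x), map_zero]

/-- Additivity is a consequence of exactness on the split triangle of `Y ⊞ Y`, which decomposes an
element there into its two restrictions. -/
theorem res_add {X Y : C} (f g : X ⟶ Y) (x : F.obj (op Y)) :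
    res F (f + g) x = res F f x + res F g x := by
  have key (c : F.obj (op (Y ⊞ Y))) :
      c = res F biprod.fst (res F biprod.inl c) + res F biprod.snd (res F biprod.inr c) := by
    obtain ⟨b, hb⟩ := exists_res_eq hF (binaryBiproductTriangle_distinguished Y Y)
      (x := c - res F biprod.fst (res F biprod.inl c)) (by
        rw [map_sub, ← res_comp F biprod.inl biprod.fst, biprod.inl_fst, res_id, sub_self])
    have : b = res F biprod.inr c := by
      have := congrArg (res F biprod.inr) hb
      rwa [← res_comp, biprod.inr_snd, res_id, map_sub, ← res_comp F biprod.inr biprod.fst,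
        biprod.inr_fst, res_zero hF, sub_zero] at this
    rw [← this, hb, add_sub_cancel]
  have e : f + g = biprod.lift f g ≫ biprod.desc (𝟙 Y) (𝟙 Y) := by simp
  rw [e, res_comp, key (res F (biprod.desc (𝟙 Y) (𝟙 Y)) x), map_add]
  simp only [← res_comp]
  simp

theorem res_neg {X Y : C} (f : X ⟶ Y) (x : F.obj (op Y)) :
    res F (-f) x = - res F f x := by
  rw [eq_neg_iff_add_eq_zero, ← res_add hF, neg_add_cancel, res_zero hF]

end Cohomological

namespace Thick

variable (S : Thick C)

/-- The unit `F ⟶ L_S F`. -/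
noncomputable def unit (F : AbPresheaf C) : F ⟶ S.loc.obj F := S.locUnit.app F

theorem trW_mk {N : Thick C} {X Y Z : C} {f : X ⟶ Y} {g : Y ⟶ Z} {h : Z ⟶ X⟦(1 : ℤ)⟧}
    (H : Pretriangulated.Triangle.mk f g h ∈ distTriang C) (hZ : N.carrier Z) :
    N.carrier.trW f :=
  ObjectProperty.trW.mk _ H hZ

variable {S}

theorem res_loc_bijective (F : AbPresheaf C) {X Y : C} {s : X ⟶ Y} (hs : S.carrier.trW s) :
    Function.Bijective (res (S.loc.obj F) s) := by
  have : IsIso (S.quotFunctor.map s) := Localization.inverts _ _ _ hs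
  have : IsIso ((S.loc.obj F).map s.op) := by
    change IsIso ((S.quotFunctor.op.lan.obj F).map (S.quotFunctor.map s).op)
    infer_instance
  exact res_bijective _ s

section

variable [IsTriangulated C]

theorem exists_loc_rep {F : AbPresheaf C} {X : C} (y : (S.loc.obj F).obj (op X)) :
    ∃ (Z : C) (s : Z ⟶ X) (a : F.obj (op Z)), S.carrier.trW s ∧
      res (S.loc.obj F) s y = ev (S.unit F) Z a :=
  exists_rep_of_isLeftKanExtension S.carrier.trW (L := S.quotFunctor)
    (G := S.quotFunctor.op.lan.obj F) F (S.quotFunctor.op.lanUnit.app F) y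

theorem exists_res_eq_zero {F : AbPresheaf C} {X : C} {a : F.obj (op X)}
    (ha : ev (S.unit F) X a = 0) :
    ∃ (Z : C) (s : Z ⟶ X), S.carrier.trW s ∧ res F s a = 0 :=
  exists_res_eq_zero_of_isLeftKanExtension S.carrier.trW (L := S.quotFunctor)
    (G := S.quotFunctor.op.lan.obj F) F (S.quotFunctor.op.lanUnit.app F) a ha

theorem loc_cohomological {F : AbPresheaf C} (hF : cohomological C F) :
    cohomological C (S.loc.obj F) := by
  rintro ⟨X, Y, Z, f, g, h⟩ H y
  change res _ f y = 0 ↔ y ∈ Set.range (res _ g)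
  constructor
  · intro hy
    obtain ⟨Y', s, a, hs, e⟩ := exists_loc_rep y
    obtain ⟨X', i, d, H'⟩ := Pretriangulated.distinguished_cocone_triangle₁ (s ≫ g)
    obtain ⟨t, ht, -⟩ := exists_map₁ H' H s (𝟙 Z) (by simp)
    obtain ⟨X'', r, hr, hra⟩ := exists_res_eq_zero (S := S) (a := res F i a) (by
      rw [ev_res, ← e, ← res_comp, ht, res_comp, hy, map_zero])
    obtain ⟨A, r₂, r₃, Hr, hA⟩ := (ObjectProperty.trW_iff _ _).1 hr
    obtain ⟨Z'', g'', d'', H''⟩ := Pretriangulated.distinguished_cocone_triangle (r ≫ i)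
    -- Over `X''` the representative `a` restricts to zero, so it extends to the cone `Z''`. The
    -- octahedron compares `Z''` with `Z` by a morphism whose fibre `A` lies in `S`, so the
    -- extension descends to `L_S F` at `Z`.
    let o := Triangulated.someOctahedron rfl Hr H' H''
    have hm : S.carrier.trW o.m₃ := (ObjectProperty.trW_iff' _ _).2 ⟨_, _, _, o.mem, hA⟩
    obtain ⟨c, hc⟩ := exists_res_eq hF H'' (x := a) (by rw [res_comp, hra])
    obtain ⟨w, hw⟩ := (res_loc_bijective F hm).2 (ev (S.unit F) Z'' c)
    refine ⟨w, (res_loc_bijective F hs).1 ?_⟩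
    rw [← res_comp, ← o.comm₃, res_comp, hw, e, ← hc, ev_res]
  · rintro ⟨z, rfl⟩
    rw [← res_comp, comp_zero₁₂ H]
    have h0 : (0 : X ⟶ Z) = (0 : X ⟶ 0) ≫ (0 : 0 ⟶ Z) := by simp
    rw [h0, res_comp]
    suffices ∀ x : (S.loc.obj F).obj (op 0), x = 0 by rw [this (res _ _ z), map_zero]
    intro x
    obtain ⟨Z', s, a, hs, e⟩ := exists_loc_rep x
    have : res (S.loc.obj F) (0 : 0 ⟶ Z') (res (S.loc.obj F) s x) = 0 := by
      rw [e, ← ev_res, eq_zero_of_isZero hF (isZero_zero C) (res F _ a), map_zero]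
    rwa [← res_comp, (isZero_zero C).eq_of_src (0 ≫ s) (𝟙 _), res_id] at this

end

/-- The canonical morphism `L_S F ⟶ L_S' F` on elements. -/
noncomputable abbrev tr {S S' : Thick C} (h : S ≤ S') (F : AbPresheaf C) (X : C) :
    (S.loc.obj F).obj (op X) →+ (S'.loc.obj F).obj (op X) :=
  ev ((locMap h).app F) X

theorem tr_unit {S S' : Thick C} (h : S ≤ S') (F : AbPresheaf C) (X : C) (a : F.obj (op X)) :
    tr h F X (ev (S.unit F) X a) = ev (S'.unit F) X a := by
  rw [← ev_comp]
  exact congrArg (fun t => ev t X a) (locUnit_locMapApp h F)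

theorem locMap_comp {S S' S'' : Thick C} (h : S ≤ S') (h' : S' ≤ S'') :
    locMap h ≫ locMap h' = locMap (h.trans h') := by
  ext F : 2
  apply loc_hom_ext (h.trans h')
  change S.locUnit.app F ≫ locMapApp h F ≫ locMapApp h' F = _ ≫ locMapApp _ F
  rw [← Category.assoc, locUnit_locMapApp, locUnit_locMapApp, locUnit_locMapApp]

theorem tr_tr {S S' S'' : Thick C} (h : S ≤ S') (h' : S' ≤ S'') (F : AbPresheaf C) (X : C)
    (x : (S.loc.obj F).obj (op X)) : tr h' F X (tr h F X x) = tr (h.trans h') F X x := by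
  rw [← ev_comp, ← NatTrans.comp_app, locMap_comp]

theorem tr_naturality {S S' : Thick C} (h : S ≤ S') {F G : AbPresheaf C} (φ : F ⟶ G) (X : C)
    (x : (S.loc.obj F).obj (op X)) :
    tr h G X (ev (S.loc.map φ) X x) = ev (S'.loc.map φ) X (tr h F X x) := by
  rw [← ev_comp, ← ev_comp, (locMap h).naturality]

variable [IsTriangulated C]

/-- An element of `L_S F` that dies in `L_S' F` is killed by some morphism with cone in `S'`. -/
theorem exists_res_eq_zero_of_tr {S S' : Thick C} (h : S ≤ S') {F : AbPresheaf C} {X : C}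
    {x : (S.loc.obj F).obj (op X)} (hx : tr h F X x = 0) :
    ∃ (Z : C) (s : Z ⟶ X), S'.carrier.trW s ∧ res (S.loc.obj F) s x = 0 := by
  obtain ⟨Y, s, a, hs, e⟩ := exists_loc_rep x
  obtain ⟨Z, t, ht, hta⟩ := exists_res_eq_zero (S := S') (a := a) (by
    rw [← tr_unit h, ← e, ev_res, hx, map_zero])
  refine ⟨Z, t ≫ s, S'.carrier.trW.comp_mem _ _ ht (ObjectProperty.trW_monotone h _ hs), ?_⟩
  rw [res_comp, e, ← ev_res, hta, map_zero]

/-- Every element of `L_S' F` comes, up to a morphism with cone in `S'`, from `L_S F`. -/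
theorem exists_res_eq_tr {S S' : Thick C} (h : S ≤ S') {F : AbPresheaf C} {X : C}
    (y : (S'.loc.obj F).obj (op X)) :
    ∃ (Z : C) (s : Z ⟶ X) (a : (S.loc.obj F).obj (op Z)), S'.carrier.trW s ∧
      res (S'.loc.obj F) s y = tr h F Z a := by
  obtain ⟨Z, s, a, hs, e⟩ := exists_loc_rep y
  exact ⟨Z, s, ev (S.unit F) Z a, hs, by rw [tr_unit, e]⟩

theorem loc_eq_zero_of_mem {F : AbPresheaf C} (hF : cohomological C F) {X : C}
    (hX : S.carrier X) (x : (S.loc.obj F).obj (op X)) : x = 0 := by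
  have h : S.carrier.trW (0 : 0 ⟶ X) :=
    trW_mk (Pretriangulated.contractible_distinguished₁ X) hX
  apply (res_loc_bijective F h).1
  rw [map_zero]
  exact eq_zero_of_isZero (loc_cohomological hF) (isZero_zero C) _

end Thick

end ThickCentre

/-! ### Long exact sequences and excision. -/

namespace ThickCentre

variable {C : Type u} [Category.{v} C] [HasZeroObject C] [HasShift C ℤ] [Preadditive C]
  [∀ n : ℤ, (shiftFunctor C n).Additive] [Pretriangulated C]

section Connecting

open Pretriangulated

/-- The morphism `Z⟦-1⟧ ⟶ X` corresponding, up to sign, to `h : Z ⟶ X⟦1⟧`. -/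
noncomputable def conn {X Z : C} (h : Z ⟶ X⟦(1 : ℤ)⟧) : Z⟦(-1 : ℤ)⟧ ⟶ X :=
  -(h⟦(-1 : ℤ)⟧' ≫ (shiftFunctorCompIsoId C (1 : ℤ) (-1) (add_neg_cancel 1)).hom.app X)

omit [HasZeroObject C] [∀ (n : ℤ), (shiftFunctor C n).Additive] [Pretriangulated C] in
theorem conn_naturality {X Z X' Z' : C} {h : Z ⟶ X⟦(1 : ℤ)⟧} {h' : Z' ⟶ X'⟦(1 : ℤ)⟧}
    {a : X ⟶ X'} {c : Z ⟶ Z'} (w : h ≫ a⟦(1 : ℤ)⟧' = c ≫ h') :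
    conn h ≫ a = c⟦(-1 : ℤ)⟧' ≫ conn h' := by
  have e := (shiftFunctorCompIsoId C (1 : ℤ) (-1) (add_neg_cancel 1)).hom.naturality a
  have w' := congrArg (fun t => t⟦(-1 : ℤ)⟧') w
  dsimp at e
  simp only [Functor.map_comp] at w'
  rw [conn, conn, Preadditive.neg_comp, Preadditive.comp_neg, Category.assoc, ← e,
    reassoc_of% w']

theorem conn_distinguished {X Y Z : C} {f : X ⟶ Y} {g : Y ⟶ Z} {h : Z ⟶ X⟦(1 : ℤ)⟧}
    (H : Triangle.mk f g h ∈ distTriang C) :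
    Triangle.mk (conn h) f
      (g ≫ (shiftFunctorCompIsoId C (-1 : ℤ) 1 (neg_add_cancel 1)).inv.app Z) ∈ distTriang C :=
  inv_rot_of_distTriang _ H

omit [HasZeroObject C] [∀ (n : ℤ), (shiftFunctor C n).Additive] [Pretriangulated C] in
-- Rotating backwards twice gives exactness at `Z⟦-1⟧`; the sign does not affect kernels.
theorem conn_comp_inv {Y Z : C} (g : Y ⟶ Z) :
    conn (g ≫ (shiftFunctorCompIsoId C (-1 : ℤ) 1 (neg_add_cancel 1)).inv.app Z) =
      -g⟦(-1 : ℤ)⟧' := by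
  rw [conn, Functor.map_comp, Category.assoc]
  simp [shift_shiftFunctorCompIsoId_inv_app]

variable {F : AbPresheaf C} (hF : cohomological C F)
  {X Y Z : C} {f : X ⟶ Y} {g : Y ⟶ Z} {h : Z ⟶ X⟦(1 : ℤ)⟧}

include hF

theorem exists_res_eq_of_conn (H : Triangle.mk f g h ∈ distTriang C) {x : F.obj (op X)}
    (hx : res F (conn h) x = 0) : ∃ y : F.obj (op Y), res F f y = x :=
  exists_res_eq hF (conn_distinguished H) hx

theorem res_conn_res (H : Triangle.mk f g h ∈ distTriang C) (y : F.obj (op Y)) :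
    res F (conn h) (res F f y) = 0 :=
  res_res_eq_zero hF (conn_distinguished H) y

theorem exists_res_conn_eq (H : Triangle.mk f g h ∈ distTriang C) {z : F.obj (op (Z⟦(-1 : ℤ)⟧))}
    (hz : res F (g⟦(-1 : ℤ)⟧') z = 0) : ∃ x : F.obj (op X), res F (conn h) x = z := by
  refine exists_res_eq_of_conn hF (conn_distinguished H) ?_
  rw [conn_comp_inv, res_neg hF, hz, neg_zero]

theorem res_shift_res_conn (H : Triangle.mk f g h ∈ distTriang C) (x : F.obj (op X)) :
    res F (g⟦(-1 : ℤ)⟧') (res F (conn h) x) = 0 := by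
  have := res_conn_res hF (conn_distinguished H) x
  rwa [conn_comp_inv, res_neg hF, neg_eq_zero] at this

end Connecting

namespace Thick

section Excision

variable [IsTriangulated C]

omit [IsTriangulated C] in
-- The fibre of the first factor `W ⟶ Z` maps to `W'`, so among morphisms to `W` with cone in `V`
-- those with cone in `N` are cofinal. Localising by either then has the same effect at `W`.
theorem exists_trW_of_factors {N V : Thick C} {W W' : C}
    (hfac : ∀ ⦃B : C⦄ (f : W ⟶ B), V.carrier B → N.Factors f) {s : W' ⟶ W}
    (hs : V.carrier.trW s) :
    ∃ (W'' : C) (t : W'' ⟶ W'), N.carrier.trW (t ≫ s) := by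
  obtain ⟨B, g, h, H, hB⟩ := (ObjectProperty.trW_iff _ _).1 hs
  obtain ⟨Z, a, b, hZ, rfl⟩ := hfac g hB
  obtain ⟨W'', r, d, H'⟩ := Pretriangulated.distinguished_cocone_triangle₁ a
  obtain ⟨t, ht⟩ := exists_lift H r (by rw [← Category.assoc, comp_zero₁₂ H', zero_comp])
  exact ⟨W'', t, ht ▸ trW_mk H' hZ⟩

theorem tr_bijective_of_factors {N V : Thick C} (hN : N ≤ V) (F : AbPresheaf C) {W : C}
    (hfac : ∀ ⦃B : C⦄ (f : W ⟶ B), V.carrier B → N.Factors f) :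
    Function.Bijective (tr hN F W) := by
  constructor
  · refine (injective_iff_map_eq_zero _).2 fun x hx => ?_
    obtain ⟨W', s, hs, e⟩ := exists_res_eq_zero_of_tr hN hx
    obtain ⟨W'', t, ht⟩ := exists_trW_of_factors hfac hs
    apply (res_loc_bijective F ht).1
    rw [res_comp, e, map_zero, map_zero]
  · intro y
    obtain ⟨W', s, a, hs, e⟩ := exists_res_eq_tr hN y
    obtain ⟨W'', t, ht⟩ := exists_trW_of_factors hfac hs
    obtain ⟨x, hx⟩ := (res_loc_bijective F ht).2 (res _ t a)
    refine ⟨x, (res_loc_bijective F (ObjectProperty.trW_monotone hN _ ht)).1 ?_⟩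
    rw [← ev_res, hx, ev_res, ← e, ← res_comp]

/-- The presheaf `F` is excisive at `W` if `L_{U ⊓ V} F ⟶ L_U F ⊞ L_V F` is bijective at `W`. -/
structure Excisive (U V : Thick C) (F : AbPresheaf C) (W : C) : Prop where
  eq_zero : ∀ x : ((U ⊓ V).loc.obj F).obj (op W), tr inf_le_left F W x = 0 →
    tr inf_le_right F W x = 0 → x = 0
  exists_eq : ∀ (y : (U.loc.obj F).obj (op W)) (z : (V.loc.obj F).obj (op W)),
    ∃ x : ((U ⊓ V).loc.obj F).obj (op W),
      tr inf_le_left F W x = y ∧ tr inf_le_right F W x = z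

variable {U V : Thick C} {F : AbPresheaf C}

omit [IsTriangulated C] in
theorem Excisive.of_retract {W W' : C} (r : Retract W' W) (hW : Excisive U V F W) :
    Excisive U V F W' where
  eq_zero x h₁ h₂ := by
    have := hW.eq_zero (res _ r.r x) (by rw [ev_res, h₁, map_zero]) (by rw [ev_res, h₂, map_zero])
    rw [← res_id _ x, ← r.retract, res_comp, this, map_zero]
  exists_eq y z := by
    obtain ⟨x, h₁, h₂⟩ := hW.exists_eq (res _ r.r y) (res _ r.r z)
    refine ⟨res _ r.i x, ?_, ?_⟩
    · rw [ev_res, h₁, ← res_comp, r.retract, res_id]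
    · rw [ev_res, h₂, ← res_comp, r.retract, res_id]

/-- The five lemma: the neighbour `X⟦1⟧` serves injectivity and `Z⟦-1⟧` serves surjectivity, which
is why `excisive` quantifies over all shifts. -/
theorem Excisive.ext₂ (hF : cohomological C F) {X Y Z : C} {f : X ⟶ Y} {g : Y ⟶ Z}
    {h : Z ⟶ X⟦(1 : ℤ)⟧} (H : Pretriangulated.Triangle.mk f g h ∈ distTriang C)
    (h₁ : Excisive U V F (X⟦(1 : ℤ)⟧)) (h₂ : Excisive U V F Z) (h₃ : Excisive U V F X)
    (h₄ : Excisive U V F (Z⟦(-1 : ℤ)⟧)) : Excisive U V F Y := by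
  have hL (S : Thick C) := loc_cohomological (S := S) hF
  have H' := Pretriangulated.rot_of_distTriang _ H
  constructor
  · intro y hU hV
    obtain ⟨z, rfl⟩ := exists_res_eq (hL _) H
      (h₃.eq_zero (res _ f y) (by rw [ev_res, hU, map_zero]) (by rw [ev_res, hV, map_zero]))
    rw [ev_res] at hU hV
    obtain ⟨s, hs⟩ := exists_res_eq (hL _) H' hU
    obtain ⟨t, ht⟩ := exists_res_eq (hL _) H' hV
    obtain ⟨w, rfl, rfl⟩ := h₁.exists_eq s t
    have : z = res _ h w := by
      rw [← sub_eq_zero]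
      refine h₂.eq_zero _ ?_ ?_
      · rw [map_sub, ev_res, ← hs]
        exact sub_self _
      · rw [map_sub, ev_res, ← ht]
        exact sub_self _
    rw [this]
    exact res_res_eq_zero (hL _) H' w
  · intro s t
    obtain ⟨x, hx₁, hx₂⟩ := h₃.exists_eq (res _ f s) (res _ f t)
    obtain ⟨y, rfl⟩ := exists_res_eq_of_conn (hL _) H (x := x) (h₄.eq_zero _
      (by rw [ev_res, hx₁, res_conn_res (hL _) H]) (by rw [ev_res, hx₂, res_conn_res (hL _) H]))
    rw [ev_res] at hx₁ hx₂
    obtain ⟨s', hs'⟩ := exists_res_eq (hL _) H (x := s - tr inf_le_left F Y y)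
      (by rw [map_sub, hx₁, sub_self])
    obtain ⟨t', ht'⟩ := exists_res_eq (hL _) H (x := t - tr inf_le_right F Y y)
      (by rw [map_sub, hx₂, sub_self])
    obtain ⟨z, rfl, rfl⟩ := h₂.exists_eq s' t'
    refine ⟨y + res _ g z, ?_, ?_⟩
    · rw [map_add, ev_res, hs', add_sub_cancel]
    · rw [map_add, ev_res, ht', add_sub_cancel]

/-- The thick subcategory of objects all of whose shifts are excisive for `F`. -/
def excisive (U V : Thick C) (hF : cohomological C F) : Thick C where
  carrier W := ∀ n : ℤ, Excisive U V F (W⟦n⟧)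
  isStableUnderRetracts := ⟨fun r h n => (h n).of_retract (r.map (shiftFunctor C n))⟩
  isTriangulated :=
    { exists_zero := ⟨0, isZero_zero C, fun n => by
        have hz : IsZero ((0 : C)⟦n⟧) := Functor.map_isZero _ (isZero_zero C)
        exact ⟨fun x _ _ => eq_zero_of_isZero (loc_cohomological hF) hz x, fun y z =>
          ⟨0, (eq_zero_of_isZero (loc_cohomological hF) hz _).trans
            (eq_zero_of_isZero (loc_cohomological hF) hz _).symm,
            (eq_zero_of_isZero (loc_cohomological hF) hz _).trans
            (eq_zero_of_isZero (loc_cohomological hF) hz _).symm⟩⟩⟩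
      isStableUnderShiftBy := fun m => ⟨fun X hX n =>
        (hX (m + n)).of_retract (.ofIso ((shiftFunctorAdd C m n).app X).symm)⟩
      ext₂' := fun T hT h₁ h₃ => ObjectProperty.le_isoClosure _ _ fun n =>
        Excisive.ext₂ hF (Pretriangulated.Triangle.shift_distinguished T hT n)
          ((h₁ (n + 1)).of_retract (.ofIso ((shiftFunctorAdd C n 1).app T.obj₁).symm)) (h₃ n)
          (h₁ n) ((h₃ (n + -1)).of_retract (.ofIso ((shiftFunctorAdd C n (-1)).app T.obj₃).symm)) }

theorem Commute.excisive_left (h : Commute U V) (hF : cohomological C F) {W : C}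
    (hW : U.carrier W) : Excisive U V F W := by
  have hb := tr_bijective_of_factors (N := U ⊓ V) inf_le_right F
    fun B f hB => h.left_factors f hW hB
  refine ⟨fun x _ hx => (injective_iff_map_eq_zero _).1 hb.1 x hx, fun y z => ?_⟩
  obtain ⟨x, hx⟩ := hb.2 z
  exact ⟨x, (loc_eq_zero_of_mem hF hW _).trans (loc_eq_zero_of_mem hF hW _).symm, hx⟩

theorem Commute.excisive_right (h : Commute U V) (hF : cohomological C F) {W : C}
    (hW : V.carrier W) : Excisive U V F W := by
  have hb := tr_bijective_of_factors (N := U ⊓ V) inf_le_left F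
    fun B f hB => h.right_factors f hW hB
  refine ⟨fun x hx _ => (injective_iff_map_eq_zero _).1 hb.1 x hx, fun y z => ?_⟩
  obtain ⟨x, hx⟩ := hb.2 y
  exact ⟨x, hx, (loc_eq_zero_of_mem hF hW _).trans (loc_eq_zero_of_mem hF hW _).symm⟩

theorem Commute.excisive (h : Commute U V) (hF : cohomological C F) {W : C}
    (hW : (U ⊔ V).carrier W) : Excisive U V F W := by
  have : U ⊔ V ≤ Thick.excisive U V hF :=
    sup_le (fun X hX n => h.excisive_left hF (U.carrier.le_shift n X hX))
      (fun X hX n => h.excisive_right hF (V.carrier.le_shift n X hX))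
  exact (this W hW 0).of_retract (.ofIso ((shiftFunctorZero C ℤ).app W).symm)

end Excision

end Thick

end ThickCentre

/-! ### The connecting homomorphism and exactness. -/

namespace ThickCentre

variable {C : Type u} [Category.{v} C] [HasZeroObject C] [HasShift C ℤ] [Preadditive C]
  [∀ n : ℤ, (shiftFunctor C n).Additive] [Pretriangulated C]

namespace Thick

section Delta

variable (U V : Thick C) (F : AbPresheaf C)

/-- The connecting relation of the Mayer–Vietoris sequence, computed with the triangle
`Q ⟶ X ⟶ W ⟶ Q⟦1⟧` and an element `a` over `Q`: restrict `a` to `W⟦-1⟧`, split it by excision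
into a `U`-part and a `V`-part and restrict the `U`-part to `X⟦-1⟧`. -/
def ConnectsAt {Q X W : C} (f : Q ⟶ X) (g : X ⟶ W) (h : W ⟶ Q⟦(1 : ℤ)⟧)
    (y : ((U ⊔ V).loc.obj F).obj (op X)) (z : ((U ⊓ V).loc.obj F).obj (op (X⟦(-1 : ℤ)⟧)))
    (a : ((U ⊓ V).loc.obj F).obj (op Q)) : Prop :=
  res ((U ⊔ V).loc.obj F) f y = tr inf_le_sup F Q a ∧
    ∃ b : ((U ⊓ V).loc.obj F).obj (op (W⟦(-1 : ℤ)⟧)),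
      tr inf_le_left F _ b = tr inf_le_left F _ (res _ (conn h) a) ∧
      tr inf_le_right F _ b = 0 ∧ res _ (g⟦(-1 : ℤ)⟧') b = z

/-- The connecting relation of the Mayer–Vietoris sequence. -/
def Connects {X : C} (y : ((U ⊔ V).loc.obj F).obj (op X))
    (z : ((U ⊓ V).loc.obj F).obj (op (X⟦(-1 : ℤ)⟧))) : Prop :=
  ∃ (Q W : C) (f : Q ⟶ X) (g : X ⟶ W) (h : W ⟶ Q⟦(1 : ℤ)⟧)
    (a : ((U ⊓ V).loc.obj F).obj (op Q)),
    Pretriangulated.Triangle.mk f g h ∈ distTriang C ∧ (U ⊔ V).carrier W ∧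
      ConnectsAt U V F f g h y z a

variable {U V F}

theorem ConnectsAt.pull {Q X W Q' X' W' : C} {f : Q ⟶ X} {g : X ⟶ W} {h : W ⟶ Q⟦(1 : ℤ)⟧}
    {f' : Q' ⟶ X'} {g' : X' ⟶ W'} {h' : W' ⟶ Q'⟦(1 : ℤ)⟧}
    {y : ((U ⊔ V).loc.obj F).obj (op X)} {z : ((U ⊓ V).loc.obj F).obj (op (X⟦(-1 : ℤ)⟧))}
    {a : ((U ⊓ V).loc.obj F).obj (op Q)} (H : ConnectsAt U V F f g h y z a)
    (t : Q' ⟶ Q) (k : X' ⟶ X) (c : W' ⟶ W) (e₁ : f' ≫ k = t ≫ f) (e₂ : g' ≫ c = k ≫ g)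
    (e₃ : h' ≫ t⟦(1 : ℤ)⟧' = c ≫ h) :
    ConnectsAt U V F f' g' h' (res _ k y) (res _ (k⟦(-1 : ℤ)⟧') z) (res _ t a) := by
  obtain ⟨hy, b, hU, hV, rfl⟩ := H
  refine ⟨?_, res _ (c⟦(-1 : ℤ)⟧') b, ?_, ?_, ?_⟩
  · rw [← res_comp, e₁, res_comp, hy, ev_res]
  · rw [ev_res, hU, ← ev_res, ← res_comp, ← res_comp, conn_naturality e₃]
  · rw [ev_res, hV, map_zero]
  · rw [← res_comp, ← res_comp, ← Functor.map_comp, ← Functor.map_comp, e₂]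

/-- The relation survives a finer `Q'`, so two choices can be compared over a common refinement. -/
theorem ConnectsAt.refine {Q X W Q' W' : C} {f : Q ⟶ X} {g : X ⟶ W} {h : W ⟶ Q⟦(1 : ℤ)⟧}
    {g' : X ⟶ W'} {h' : W' ⟶ Q'⟦(1 : ℤ)⟧} {y : ((U ⊔ V).loc.obj F).obj (op X)}
    {z : ((U ⊓ V).loc.obj F).obj (op (X⟦(-1 : ℤ)⟧))} {a : ((U ⊓ V).loc.obj F).obj (op Q)}
    (H : ConnectsAt U V F f g h y z a) (HT : Pretriangulated.Triangle.mk f g h ∈ distTriang C)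
    {t : Q' ⟶ Q} {f' : Q' ⟶ X} (e : f' = t ≫ f)
    (HT' : Pretriangulated.Triangle.mk f' g' h' ∈ distTriang C) :
    ConnectsAt U V F f' g' h' y z (res _ t a) := by
  obtain ⟨c, e₂, e₃⟩ := exists_map₃ HT' HT t (𝟙 X) ((Category.comp_id _).trans e)
  have := H.pull t (𝟙 X) c ((Category.comp_id _).trans e) e₂ e₃
  rw [(shiftFunctor C (-1)).map_id] at this
  erw [res_id, res_id] at this
  exact this

theorem ConnectsAt.sub {Q X W : C} {f : Q ⟶ X} {g : X ⟶ W} {h : W ⟶ Q⟦(1 : ℤ)⟧}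
    {y y' : ((U ⊔ V).loc.obj F).obj (op X)}
    {z z' : ((U ⊓ V).loc.obj F).obj (op (X⟦(-1 : ℤ)⟧))}
    {a a' : ((U ⊓ V).loc.obj F).obj (op Q)} (H : ConnectsAt U V F f g h y z a)
    (H' : ConnectsAt U V F f g h y' z' a') :
    ConnectsAt U V F f g h (y - y') (z - z') (a - a') := by
  obtain ⟨hy, b, hU, hV, rfl⟩ := H
  obtain ⟨hy', b', hU', hV', rfl⟩ := H'
  refine ⟨by simp only [map_sub, hy, hy'], b - b', ?_, ?_, map_sub _ _ _⟩
  · simp only [map_sub, hU, hU']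
  · rw [map_sub, hV, hV', sub_zero]

theorem Connects.map {G : AbPresheaf C} (φ : F ⟶ G) {X : C}
    {y : ((U ⊔ V).loc.obj F).obj (op X)} {z : ((U ⊓ V).loc.obj F).obj (op (X⟦(-1 : ℤ)⟧))}
    (H : Connects U V F y z) :
    Connects U V G (ev ((U ⊔ V).loc.map φ) _ y) (ev ((U ⊓ V).loc.map φ) _ z) := by
  obtain ⟨Q, W, f, g, h, a, HT, hW, hy, b, hU, hV, rfl⟩ := H
  refine ⟨Q, W, f, g, h, ev ((U ⊓ V).loc.map φ) _ a, HT, hW, ?_,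
    ev ((U ⊓ V).loc.map φ) _ b, ?_, ?_, ?_⟩
  · rw [← ev_res, hy, tr_naturality]
  · rw [tr_naturality, hU, ← tr_naturality, ev_res]
  · rw [tr_naturality, hV, map_zero]
  · rw [ev_res]

theorem Connects.res {X X' : C} (k : X' ⟶ X)
    {y : ((U ⊔ V).loc.obj F).obj (op X)} {z : ((U ⊓ V).loc.obj F).obj (op (X⟦(-1 : ℤ)⟧))}
    (H : Connects U V F y z) :
    Connects U V F (res _ k y) (ThickCentre.res _ (k⟦(-1 : ℤ)⟧') z) := by
  obtain ⟨Q, W, f, g, h, a, HT, hW, H⟩ := H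
  obtain ⟨Q', f', h', HT'⟩ := Pretriangulated.distinguished_cocone_triangle₁ (k ≫ g)
  obtain ⟨t, e₁, e₃⟩ := exists_map₁ HT' HT k (𝟙 W) (Category.comp_id _)
  exact ⟨Q', W, f', k ≫ g, h', _, HT', hW, H.pull t k (𝟙 W) e₁ (Category.comp_id _) e₃⟩

variable [IsTriangulated C]

theorem Connects.sub {X : C} {y y' : ((U ⊔ V).loc.obj F).obj (op X)}
    {z z' : ((U ⊓ V).loc.obj F).obj (op (X⟦(-1 : ℤ)⟧))} (H : Connects U V F y z)
    (H' : Connects U V F y' z') : Connects U V F (y - y') (z - z') := by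
  obtain ⟨Q, W, f, g, h, a, HT, hW, H⟩ := H
  obtain ⟨Q', W', f', g', h', a', HT', hW', H'⟩ := H'
  obtain ⟨χ, e⟩ := MorphismProperty.HasRightCalculusOfFractions.exists_rightFraction
    (W := (U ⊔ V).carrier.trW) (MorphismProperty.LeftFraction.mk f f' (trW_mk HT' hW'))
  dsimp at e
  obtain ⟨W'', g'', h'', HT'', hW''⟩ := (ObjectProperty.trW_iff _ _).1
    ((U ⊔ V).carrier.trW.comp_mem _ _ χ.hs (trW_mk HT hW))
  exact ⟨_, _, _, _, _, _, HT'', hW'', (H.refine HT rfl HT'').sub (H'.refine HT' e HT'')⟩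

/-- Well-definedness: after refining `Q` the lift `a` of zero vanishes, and then excision at `W⟦-1⟧`
forces `b = 0`. -/
theorem Connects.eq_zero (hUV : Commute U V) (hF : cohomological C F) {X : C}
    {z : ((U ⊓ V).loc.obj F).obj (op (X⟦(-1 : ℤ)⟧))} (H : Connects U V F 0 z) : z = 0 := by
  obtain ⟨Q, W, f, g, h, a, HT, hW, H⟩ := H
  obtain ⟨Q', s, hs, hsa⟩ := exists_res_eq_zero_of_tr (inf_le_sup (a := U) (b := V)) (x := a)
    (by rw [← H.1, map_zero])
  obtain ⟨W', g', h', HT', hW'⟩ := (ObjectProperty.trW_iff _ _).1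
    ((U ⊔ V).carrier.trW.comp_mem _ _ hs (trW_mk HT hW))
  obtain ⟨-, b, hU, hV, rfl⟩ := H.refine HT rfl HT'
  have : b = 0 := (hUV.excisive hF ((U ⊔ V).carrier.le_shift (-1) _ hW')).eq_zero b
    (by rw [hU, hsa, map_zero, map_zero]) hV
  rw [this, map_zero]

theorem exists_connects (hUV : Commute U V) (hF : cohomological C F) {X : C}
    (y : ((U ⊔ V).loc.obj F).obj (op X)) : ∃ z, Connects U V F y z := by
  obtain ⟨Q, f, a, hf, e⟩ := exists_res_eq_tr (inf_le_sup (a := U) (b := V)) y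
  obtain ⟨W, g, h, H, hW⟩ := (ObjectProperty.trW_iff _ _).1 hf
  obtain ⟨b, hU, hV⟩ := (hUV.excisive hF ((U ⊔ V).carrier.le_shift (-1) _ hW)).exists_eq
    (tr inf_le_left F _ (res _ (conn h) a)) 0
  exact ⟨_, Q, W, f, g, h, a, H, hW, e, b, hU, hV, rfl⟩

theorem Connects.unique (hUV : Commute U V) (hF : cohomological C F) {X : C}
    {y : ((U ⊔ V).loc.obj F).obj (op X)} {z z' : ((U ⊓ V).loc.obj F).obj (op (X⟦(-1 : ℤ)⟧))}
    (H : Connects U V F y z) (H' : Connects U V F y z') : z = z' := by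
  have := H.sub H'
  rw [sub_self] at this
  exact sub_eq_zero.1 (this.eq_zero hUV hF)

/-- The connecting homomorphism of the Mayer–Vietoris sequence. -/
noncomputable def delta (hUV : Commute U V) (hF : cohomological C F) (X : C) :
    ((U ⊔ V).loc.obj F).obj (op X) →+ ((U ⊓ V).loc.obj F).obj (op (X⟦(-1 : ℤ)⟧)) :=
  AddMonoidHom.ofMapSub (fun y => (exists_connects hUV hF y).choose) fun _ _ =>
    (exists_connects hUV hF _).choose_spec.unique hUV hF
      ((exists_connects hUV hF _).choose_spec.sub (exists_connects hUV hF _).choose_spec)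

theorem connects_delta (hUV : Commute U V) (hF : cohomological C F) {X : C}
    (y : ((U ⊔ V).loc.obj F).obj (op X)) : Connects U V F y (delta hUV hF X y) :=
  (exists_connects hUV hF y).choose_spec

theorem Connects.delta_eq (hUV : Commute U V) (hF : cohomological C F) {X : C}
    {y : ((U ⊔ V).loc.obj F).obj (op X)} {z : ((U ⊓ V).loc.obj F).obj (op (X⟦(-1 : ℤ)⟧))}
    (H : Connects U V F y z) : delta hUV hF X y = z :=
  (connects_delta hUV hF y).unique hUV hF H

end Delta

section Exact

variable [IsTriangulated C] {U V : Thick C} {F : AbPresheaf C} (hUV : Commute U V)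
  (hF : cohomological C F) {X : C}

include hUV hF

theorem delta_tr_left (u : (U.loc.obj F).obj (op X)) :
    delta hUV hF X (tr le_sup_left F X u) = 0 := by
  obtain ⟨Q, f, a, hf, e⟩ := exists_res_eq_tr (inf_le_left (a := U) (b := V)) u
  obtain ⟨W, g, h, H, hW⟩ := (ObjectProperty.trW_iff _ _).1 hf
  -- Here `W` lies in `U`, so `L_U F` vanishes at `W⟦-1⟧` and the `U`-part is zero.
  refine Connects.delta_eq hUV hF ⟨Q, W, f, g, h, a, H, le_sup_left (a := U) W hW, ?_, 0, ?_,
    map_zero _, map_zero _⟩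
  · rw [← ev_res, e, tr_tr]
  · rw [map_zero]
    exact (loc_eq_zero_of_mem hF (U.carrier.le_shift (-1) _ hW) _).symm

theorem delta_tr_right (w : (V.loc.obj F).obj (op X)) :
    delta hUV hF X (tr le_sup_right F X w) = 0 := by
  obtain ⟨Q, f, a, hf, e⟩ := exists_res_eq_tr (inf_le_right (a := U) (b := V)) w
  obtain ⟨W, g, h, H, hW⟩ := (ObjectProperty.trW_iff _ _).1 hf
  -- Now `L_V F` vanishes at `W⟦-1⟧`, so the `U`-part is the whole restriction of `a`, which dies on
  -- `X⟦-1⟧`.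
  refine Connects.delta_eq hUV hF ⟨Q, W, f, g, h, a, H, le_sup_right (a := U) W hW, ?_,
    res _ (conn h) a, rfl, loc_eq_zero_of_mem hF (V.carrier.le_shift (-1) _ hW) _,
    res_shift_res_conn (loc_cohomological hF) H a⟩
  rw [← ev_res, e, tr_tr]

theorem tr_delta (y : ((U ⊔ V).loc.obj F).obj (op X)) :
    tr inf_le_left F _ (delta hUV hF X y) = 0 ∧ tr inf_le_right F _ (delta hUV hF X y) = 0 := by
  obtain ⟨Q, W, f, g, h, a, HT, hW, hy, b, hU, hV, hz⟩ := connects_delta hUV hF y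
  rw [← hz, ev_res, ev_res, hU, hV, ← ev_res,
    res_shift_res_conn (loc_cohomological hF) HT, map_zero, map_zero]
  exact ⟨rfl, rfl⟩

theorem exists_of_delta_eq_zero {y : ((U ⊔ V).loc.obj F).obj (op X)}
    (hy : delta hUV hF X y = 0) :
    ∃ (u : (U.loc.obj F).obj (op X)) (w : (V.loc.obj F).obj (op X)),
      tr le_sup_left F X u + tr le_sup_right F X w = y := by
  have hL (S : Thick C) := loc_cohomological (S := S) hF
  obtain ⟨Q, W, f, g, h, a, H, hW, ha, b, hU, hV, hz⟩ := connects_delta hUV hF y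
  rw [hy] at hz
  -- Thus `b` comes from some `c` over `Q`, and `a = (a - c) + c`: the first term extends over `X`
  -- in `L_U F`, the second in `L_V F`.
  obtain ⟨c, rfl⟩ := exists_res_conn_eq (hL _) H hz
  obtain ⟨u, hu⟩ := exists_res_eq_of_conn (hL _) H (x := tr inf_le_left F Q (a - c)) (by
    rw [← ev_res, map_sub, map_sub, hU, sub_self])
  obtain ⟨w, hw⟩ := exists_res_eq_of_conn (hL _) H (x := tr inf_le_right F Q c) (by
    rw [← ev_res, hV])
  refine ⟨u, w, (res_loc_bijective F (trW_mk H hW)).1 ?_⟩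
  rw [map_add, ← ev_res, ← ev_res, hu, hw, tr_tr, tr_tr, ha, ← map_add, sub_add_cancel]

theorem exists_of_tr_eq_tr {u : (U.loc.obj F).obj (op X)} {w : (V.loc.obj F).obj (op X)}
    (e : tr le_sup_left F X u = tr le_sup_right F X w) :
    ∃ z : ((U ⊓ V).loc.obj F).obj (op X), tr inf_le_left F X z = u ∧
      tr inf_le_right F X z = w := by
  have hL (S : Thick C) := loc_cohomological (S := S) hF
  obtain ⟨Q₁, f₁, a₁, hf₁, e₁⟩ := exists_res_eq_tr (inf_le_left (a := U) (b := V)) u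
  obtain ⟨Q₂, f₂, a₂, hf₂, e₂⟩ := exists_res_eq_tr (inf_le_right (a := U) (b := V)) w
  have hf₁' := ObjectProperty.trW_monotone (le_sup_left : U ≤ U ⊔ V) _ hf₁
  have hf₂' := ObjectProperty.trW_monotone (le_sup_right : V ≤ U ⊔ V) _ hf₂
  obtain ⟨χ, eχ⟩ := MorphismProperty.HasRightCalculusOfFractions.exists_rightFraction
    (W := (U ⊔ V).carrier.trW) (MorphismProperty.LeftFraction.mk f₁ f₂ hf₂')
  dsimp at eχ
  obtain ⟨Q, t, ht, hta⟩ := exists_res_eq_zero_of_tr (inf_le_sup (a := U) (b := V))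
    (x := res _ χ.s a₁ - res _ χ.f a₂) (by
      rw [map_sub, ev_res, ev_res, ← tr_tr inf_le_left le_sup_left,
        ← tr_tr inf_le_right le_sup_right, ← e₁, ← e₂, ev_res, ev_res, ← res_comp, ← res_comp,
        e, eχ, sub_self])
  rw [map_sub, sub_eq_zero, ← res_comp, ← res_comp] at hta
  obtain ⟨W, g, h, H, hW⟩ := (ObjectProperty.trW_iff _ _).1
    ((U ⊔ V).carrier.trW.comp_mem _ _ ht ((U ⊔ V).carrier.trW.comp_mem _ _ χ.hs hf₁'))
  have hu : res _ (t ≫ χ.s ≫ f₁) u = tr inf_le_left F Q (res _ (t ≫ χ.s) a₁) := by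
    rw [ev_res, ← e₁, ← res_comp, Category.assoc]
  have hw : res _ (t ≫ χ.s ≫ f₁) w = tr inf_le_right F Q (res _ (t ≫ χ.s) a₁) := by
    rw [hta, ev_res, ← e₂, ← res_comp, Category.assoc, eχ]
  have hW' := (U ⊔ V).carrier.le_shift (-1) _ hW
  -- Over `Q` one element induces both `u` and `w`. Injectivity of excision at `W⟦-1⟧` extends it to
  -- `X`; surjectivity at `W` corrects the remaining differences.
  obtain ⟨z, hz⟩ := exists_res_eq_of_conn (hL _) H (x := res _ (t ≫ χ.s) a₁)
    ((hUV.excisive hF hW').eq_zero _ (by rw [ev_res, ← hu, res_conn_res (hL _) H])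
      (by rw [ev_res, ← hw, res_conn_res (hL _) H]))
  obtain ⟨s₁, hs₁⟩ := exists_res_eq (hL _) H (x := u - tr inf_le_left F X z) (by
    rw [map_sub, ← ev_res, hz, hu, sub_self])
  obtain ⟨s₂, hs₂⟩ := exists_res_eq (hL _) H (x := w - tr inf_le_right F X z) (by
    rw [map_sub, ← ev_res, hz, hw, sub_self])
  obtain ⟨s, rfl, rfl⟩ := (hUV.excisive hF hW).exists_eq s₁ s₂
  refine ⟨z + res _ g s, ?_, ?_⟩
  · rw [map_add, ev_res, hs₁, add_sub_cancel]
  · rw [map_add, ev_res, hs₂, add_sub_cancel]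

theorem exists_delta_eq {z : ((U ⊓ V).loc.obj F).obj (op (X⟦(-1 : ℤ)⟧))}
    (hU : tr inf_le_left F _ z = 0) (hV : tr inf_le_right F _ z = 0) :
    ∃ y, delta hUV hF X y = z := by
  have hL (S : Thick C) := loc_cohomological (S := S) hF
  obtain ⟨Q₀, s, hs, hsz⟩ := exists_res_eq_zero_of_tr _ hU
  obtain ⟨A₀, q, d, H₀, hA₀⟩ := (ObjectProperty.trW_iff _ _).1 hs
  obtain ⟨w₀, hw₀⟩ := exists_res_eq (hL _) H₀ hsz
  -- Desuspending makes `z` the restriction of `w` along `g⟦-1⟧` for some `g : X ⟶ A` with `A` in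
  -- `U`.
  obtain ⟨A, hA, ⟨i⟩⟩ : ∃ A : C, U.carrier A ∧ Nonempty (A⟦(-1 : ℤ)⟧ ≅ A₀) :=
    ⟨A₀⟦(1 : ℤ)⟧, U.carrier.le_shift _ _ hA₀,
      ⟨(shiftFunctorCompIsoId C (1 : ℤ) (-1) (add_neg_cancel 1)).app A₀⟩⟩
  obtain ⟨g, hg⟩ := (shiftFunctor C (-1 : ℤ)).map_surjective (q ≫ i.inv)
  obtain ⟨w, hw⟩ : ∃ w, res _ (g⟦(-1 : ℤ)⟧') w = z := ⟨res _ i.hom w₀, by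
    rw [← res_comp, hg, Category.assoc, i.inv_hom_id, Category.comp_id, hw₀]⟩
  obtain ⟨Q, f, h, H⟩ := Pretriangulated.distinguished_cocone_triangle₁ g
  obtain ⟨c, hc⟩ := exists_res_conn_eq (hL _) H (z := tr inf_le_right F _ w) (by
    rw [← ev_res, hw, hV])
  have hAJ : (U ⊔ V).carrier A := le_sup_left (a := U) A hA
  obtain ⟨y, hy⟩ := (res_loc_bijective F (trW_mk H hAJ)).2 (tr le_sup_right F Q c)
  obtain ⟨Q', t, a, ht, ha⟩ := exists_res_eq_tr (inf_le_right (a := U) (b := V)) c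
  obtain ⟨W, g', h', H', hW⟩ := (ObjectProperty.trW_iff _ _).1
    ((U ⊔ V).carrier.trW.comp_mem _ _
      (ObjectProperty.trW_monotone (le_sup_right : V ≤ U ⊔ V) _ ht) (trW_mk H hAJ))
  obtain ⟨k, e₂, e₃⟩ := exists_map₃ H' H t (𝟙 X) (Category.comp_id _)
  rw [Category.id_comp] at e₂
  -- The sign arises because the `U`-part is the restriction of `a` minus that of `w`: subtracting
  -- `w` removes the `V`-component, and on `X⟦-1⟧` only `-z` survives.
  refine ⟨-y, ?_⟩
  rw [map_neg, neg_eq_iff_eq_neg]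
  refine Connects.delta_eq hUV hF ⟨Q', W, t ≫ f, g', h', a, H', hW, ?_,
    res _ (conn h') a - res _ (k⟦(-1 : ℤ)⟧') w, ?_, ?_, ?_⟩
  · rw [res_comp, hy, ← ev_res, ha, tr_tr]
  · rw [map_sub, ev_res _ (k⟦(-1 : ℤ)⟧'),
      loc_eq_zero_of_mem hF (U.carrier.le_shift (-1) _ hA) (tr inf_le_left F _ w), map_zero,
      sub_zero]
  · rw [map_sub, ev_res, ev_res, ← hc, ← ha, ← res_comp, ← res_comp, conn_naturality e₃,
      sub_self]
  · rw [map_sub, res_shift_res_conn (hL _) H', zero_sub, ← res_comp, ← Functor.map_comp, e₂, hw]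

end Exact

end Thick

end ThickCentre

/-! ### Assembling the Mayer–Vietoris sequence. -/

namespace ThickCentre

variable {C : Type u} [Category.{v} C] [HasZeroObject C] [HasShift C ℤ] [Preadditive C]
  [∀ n : ℤ, (shiftFunctor C n).Additive] [Pretriangulated C]

section MayerVietoris

variable (U V : Thick C) (F : AbPresheaf C) (X : C)

/-- The two components of an element of `L_U F ⊞ L_V F`. -/
noncomputable def mvEquiv : ((U.loc ⊞ V.loc).obj F).obj (op X) ≃
    (U.loc.obj F).obj (op X) × (V.loc.obj F).obj (op X) where
  toFun p := (ev ((biprod.fst : U.loc ⊞ V.loc ⟶ _).app F) X p,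
    ev ((biprod.snd : U.loc ⊞ V.loc ⟶ _).app F) X p)
  invFun q := ev ((biprod.inl : _ ⟶ U.loc ⊞ V.loc).app F) X q.1 +
    ev ((biprod.inr : _ ⟶ U.loc ⊞ V.loc).app F) X q.2
  left_inv p := by
    dsimp only
    rw [← ev_comp, ← ev_comp, ← NatTrans.comp_app, ← NatTrans.comp_app, ← ev_add,
      ← NatTrans.app_add, biprod.total]
    simp [ev]
  right_inv q := by
    ext
    · dsimp only
      rw [map_add, ← ev_comp, ← ev_comp, ← NatTrans.comp_app, ← NatTrans.comp_app,
        biprod.inl_fst, biprod.inr_fst]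
      simp [ev]
    · dsimp only
      rw [map_add, ← ev_comp, ← ev_comp, ← NatTrans.comp_app, ← NatTrans.comp_app,
        biprod.inl_snd, biprod.inr_snd]
      simp [ev]

theorem mvEquiv_mvFst (x : ((U ⊓ V).loc.obj F).obj (op X)) :
    mvEquiv U V F X (ev ((mvFst U V).app F) X x) =
      (Thick.tr inf_le_left F X x, Thick.tr inf_le_right F X x) := by
  simp only [mvEquiv, Equiv.coe_fn_mk, ← ev_comp, ← NatTrans.comp_app, mvFst, biprod.lift_fst,
    biprod.lift_snd]

theorem ev_mvSnd (p : ((U.loc ⊞ V.loc).obj F).obj (op X)) :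
    ev ((mvSnd U V).app F) X p =
      Thick.tr le_sup_left F X (mvEquiv U V F X p).1 -
        Thick.tr le_sup_right F X (mvEquiv U V F X p).2 := by
  have : mvSnd U V =
      biprod.fst ≫ Thick.locMap le_sup_left - biprod.snd ≫ Thick.locMap le_sup_right := by
    rw [mvSnd, biprod.desc_eq, Preadditive.comp_neg, sub_eq_add_neg]
  rw [this, NatTrans.app_sub, ev_sub, NatTrans.comp_app, NatTrans.comp_app, ev_comp, ev_comp]
  rfl

variable {U V} [IsTriangulated C]

open Thick

variable (hUV : Commute U V)

/-- The connecting morphism of the Mayer–Vietoris sequence. -/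
noncomputable def deltaNatTrans :
    (cohomological C).ι ⋙ (U ⊔ V).loc ⟶ (cohomological C).ι ⋙ (U ⊓ V).loc ⋙ susp C 1 where
  app F :=
    { app := fun X => AddCommGrpCat.ofHom (delta hUV F.property X.unop)
      naturality := fun X Y f => by
        ext y
        exact (((connects_delta hUV F.property y).res f.unop).delta_eq hUV F.property) }
  naturality F G φ := by
    ext X y
    exact (((connects_delta hUV F.property y).map φ.hom).delta_eq hUV G.property)

section

variable {F} (hF : cohomological C F)

include hUV hF

theorem ev_mvSnd_eq_zero_iff (p : ((U.loc ⊞ V.loc).obj F).obj (op X)) :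
    ev ((mvSnd U V).app F) X p = 0 ↔ p ∈ Set.range (ev ((mvFst U V).app F) X) := by
  rw [ev_mvSnd, sub_eq_zero]
  constructor
  · intro h
    obtain ⟨z, h₁, h₂⟩ := exists_of_tr_eq_tr hUV hF h
    refine ⟨z, (mvEquiv U V F X).injective ?_⟩
    rw [mvEquiv_mvFst, h₁, h₂]
  · rintro ⟨z, rfl⟩
    rw [mvEquiv_mvFst, tr_tr, tr_tr]

theorem delta_eq_zero_iff (y : ((U ⊔ V).loc.obj F).obj (op X)) :
    delta hUV hF X y = 0 ↔ y ∈ Set.range (ev ((mvSnd U V).app F) X) := by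
  constructor
  · intro h
    obtain ⟨u, w, rfl⟩ := exists_of_delta_eq_zero hUV hF h
    refine ⟨(mvEquiv U V F X).symm (u, -w), ?_⟩
    rw [ev_mvSnd, Equiv.apply_symm_apply, map_neg, sub_neg_eq_add]
  · rintro ⟨p, rfl⟩
    rw [ev_mvSnd, map_sub, delta_tr_left, delta_tr_right, sub_zero]

theorem ev_mvFst_eq_zero_iff (z : ((U ⊓ V).loc.obj F).obj (op (X⟦(-1 : ℤ)⟧))) :
    ev ((mvFst U V).app F) (X⟦(-1 : ℤ)⟧) z = 0 ↔ z ∈ Set.range (delta hUV hF X) := by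
  have h : ev ((mvFst U V).app F) (X⟦(-1 : ℤ)⟧) z = 0 ↔
      tr inf_le_left F _ z = 0 ∧ tr inf_le_right F _ z = 0 := by
    have h0 : mvEquiv U V F (X⟦(-1 : ℤ)⟧) 0 = (0, 0) :=
      Prod.ext (map_zero _) (map_zero _)
    rw [← (mvEquiv U V F _).injective.eq_iff, mvEquiv_mvFst, h0, Prod.mk.injEq]
  rw [h]
  constructor
  · rintro ⟨h₁, h₂⟩
    exact exists_delta_eq hUV hF h₁ h₂
  · rintro ⟨y, rfl⟩
    exact tr_delta hUV hF y

end

/-- The Mayer–Vietoris sequence of commuting thick subcategories. -/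
noncomputable def mayerVietoris : MayerVietoris U V where
  δ := deltaNatTrans hUV
  -- Suspending `n` times is evaluating at `X⟦-n⟧`, so one degree settles all.
  exact_mid n F X p := ev_mvSnd_eq_zero_iff (X.unop⟦-n⟧) hUV F.property p
  exact_sup n F X y := delta_eq_zero_iff (X.unop⟦-n⟧) hUV F.property y
  exact_inf n F X z := ev_mvFst_eq_zero_iff (X.unop⟦-n⟧) hUV F.property z

end MayerVietoris

end ThickCentre

/-! ### Points, spatiality and central support. -/

namespace ThickCentre

section Points

variable {L : Type*} [CompleteLattice L]

instance t0Space_pt : T0Space (Locale.PT L) where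
  t0 p q h := by
    ext a
    exact h.mem_open_iff (s := {x : Locale.PT L | x a}) ⟨a, rfl⟩

instance quasiSober_pt : QuasiSober (Locale.PT L) where
  sober {S} hS hS' := by
    -- The generic point of `S` sends `a` to true exactly when the open set of `a` meets `S`;
    -- irreducibility makes this preserve meets, and closedness gives the closure.
    let p : Locale.PT L :=
      { toFun := fun a => ∃ q ∈ S, q a
        map_inf' := fun a b => by
          refine propext ⟨fun ⟨q, hq, h⟩ => ?_, fun ⟨⟨q, hq, ha⟩, ⟨r, hr, hb⟩⟩ => ?_⟩
          · rw [map_inf] at h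
            exact ⟨⟨q, hq, h.1⟩, ⟨q, hq, h.2⟩⟩
          · obtain ⟨s, hs, h₁, h₂⟩ := hS.2 {x : Locale.PT L | x a} {x : Locale.PT L | x b}
              ⟨a, rfl⟩ ⟨b, rfl⟩ ⟨q, hq, ha⟩ ⟨r, hr, hb⟩
            exact ⟨s, hs, by rw [map_inf]; exact ⟨h₁, h₂⟩⟩
        map_top' := by
          obtain ⟨q, hq⟩ := hS.1
          exact propext ⟨fun _ => trivial, fun _ => ⟨q, hq, by rw [map_top]; trivial⟩⟩
        map_sSup' := fun A => by
          simp only [map_sSup, sSup_Prop_eq]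
          refine propext ⟨?_, ?_⟩
          · rintro ⟨q, hq, _, ⟨a, ha, rfl⟩, h⟩
            exact ⟨_, ⟨a, ha, rfl⟩, q, hq, h⟩
          · rintro ⟨_, ⟨a, ha, rfl⟩, q, hq, h⟩
            exact ⟨q, hq, _, ⟨a, ha, rfl⟩, h⟩ }
    refine ⟨p, ?_⟩
    rw [isGenericPoint_iff_specializes]
    intro q
    rw [specializes_iff_forall_open]
    constructor
    · intro h
      by_contra hq
      obtain ⟨a, ha⟩ := hS'.isOpen_compl
      obtain ⟨r, hr, hra⟩ := h {x : Locale.PT L | x a} ⟨a, rfl⟩ (ha ▸ hq)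
      exact (ha ▸ (show r ∈ {x : Locale.PT L | x a} from hra) : r ∈ Sᶜ) hr
    · rintro hq _ ⟨a, rfl⟩ h
      exact ⟨q, hq, h⟩

/-- If the points separate the elements of `L`, then `L` is isomorphic to the frame of open
subsets of its space of points. -/
noncomputable def opensOrderIso
    (h : ∀ a b : L, (∀ p : Locale.PT L, p a → p b) → a ≤ b) :
    L ≃o TopologicalSpace.Opens (Locale.PT L) where
  toEquiv := Equiv.ofBijective (fun a => ⟨{p | p a}, a, rfl⟩)
    ⟨fun a b e => by
      have e' : ∀ p : Locale.PT L, p a ↔ p b := fun p => by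
        have := congrArg (fun t : TopologicalSpace.Opens (Locale.PT L) => p ∈ t) e
        exact this.to_iff
      exact le_antisymm (h a b fun p => (e' p).1) (h b a fun p => (e' p).2),
    fun ⟨s, a, ha⟩ => ⟨a, TopologicalSpace.Opens.ext ha⟩⟩
  map_rel_iff' {a b} := by
    refine ⟨fun hab => h a b fun p hp => hab hp, fun hab p hp => ?_⟩
    exact OrderHomClass.mono p hab hp

/-- The point of a frame that corresponds to a prime element. -/
def pointOfPrime (P : L) (htop : ¬ ⊤ ≤ P)
    (hP : ∀ a b : L, a ⊓ b ≤ P → a ≤ P ∨ b ≤ P) : Locale.PT L where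
  toFun a := ¬ a ≤ P
  map_inf' a b := propext ⟨fun h => ⟨fun ha => h (inf_le_left.trans ha),
    fun hb => h (inf_le_right.trans hb)⟩, fun h hab => (hP a b hab).elim h.1 h.2⟩
  map_top' := propext ⟨fun _ => trivial, fun _ => htop⟩
  map_sSup' A := by
    rw [sSup_le_iff, sSup_Prop_eq]
    push Not
    refine propext ⟨?_, ?_⟩
    · rintro ⟨a, ha, h⟩
      exact ⟨_, ⟨a, ha, rfl⟩, h⟩
    · rintro ⟨_, ⟨a, ha, rfl⟩, h⟩
      exact ⟨a, ha, h⟩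

end Points

variable {C : Type u} [Category.{v} C] [HasZeroObject C] [HasShift C ℤ] [Preadditive C]
  [∀ n : ℤ, (shiftFunctor C n).Additive] [Pretriangulated C]

open Thick

section Frame

variable {T : Set (Thick C)} (hT : IsSublattice T) (hT' : ∀ S ⊆ T, sSup S ∈ T)

/-- The order on the centre is inclusion. -/
abbrev centrePartialOrder (T : Set (Thick C)) : PartialOrder (Centre T) :=
  inferInstanceAs (PartialOrder {U // U ∈ centre T})

theorem image_subset_centre (S : Set (Centre T)) : Subtype.val '' S ⊆ centre T := by
  rintro _ ⟨U, -, rfl⟩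
  exact U.2

/-- The centre is a complete lattice, with joins and binary meets as for thick subcategories. -/
abbrev centreCompleteLattice : CompleteLattice (Centre T) :=
  letI := centrePartialOrder T
  letI : SupSet (Centre T) :=
    ⟨fun S => ⟨sSup (Subtype.val '' S), sSup_mem_centre hT' (image_subset_centre S)⟩⟩
  { completeLatticeOfSup (Centre T) (fun S =>
      ⟨fun U hU => le_sSup (α := Thick C) ⟨U, hU, rfl⟩, fun U hU => sSup_le (α := Thick C) (by
        rintro _ ⟨V, hV, rfl⟩
        exact hU hV)⟩) with
    inf := fun U V => ⟨U.1 ⊓ V.1, (isSublattice_centre hT).infClosed U.2 V.2⟩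
    inf_le_left := fun U V => inf_le_left (α := Thick C)
    inf_le_right := fun U V => inf_le_right (α := Thick C)
    le_inf := fun U V W => le_inf (α := Thick C) }

/-- The centre is a frame. -/
abbrev centreFrame : Order.Frame (Centre T) :=
  letI := centreCompleteLattice hT hT'
  Order.Frame.ofMinimalAxioms
    { inf_sSup_le_iSup_inf := fun U S => by
        change U.1 ⊓ sSup (Subtype.val '' S) ≤ (⨆ V ∈ S, U ⊓ V : Centre T).1
        refine (inf_sSup_le ?_).trans (iSup₂_le ?_)
        · rintro _ ⟨V, -, rfl⟩
          exact U.2.2 _ V.2.1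
        · rintro _ ⟨V, hV, rfl⟩
          exact (le_iSup₂_of_le V hV le_rfl : U ⊓ V ≤ ⨆ V ∈ S, U ⊓ V) }

theorem exists_maximal_not_mem {V : Centre T} {X : C} (hV : ¬ V.1.carrier X) :
    letI := centreFrame hT hT'
    ∃ P : Centre T, V ≤ P ∧ Maximal (fun W : Centre T => ¬ W.1.carrier X) P := by
  let := centreFrame hT hT'
  refine zorn_le_nonempty₀ {W : Centre T | ¬ W.1.carrier X} (fun c hc hch Y hY => ?_) V hV
  refine ⟨sSup c, fun h => ?_, fun W hW => le_sSup hW⟩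
  have hch' : IsChain (· ≤ ·) (Subtype.val '' c) := by
    rintro _ ⟨W, hW, rfl⟩ _ ⟨W', hW', rfl⟩ hne
    exact hch hW hW' fun e => hne (congrArg _ e)
  change (sSup (Subtype.val '' c)).carrier X at h
  rw [mem_sSup_of_isChain hch' ⟨_, Y, hY, rfl⟩] at h
  obtain ⟨_, ⟨W, hW, rfl⟩, hX⟩ := h
  exact hc hW hX

/-- Choose `X` in `U` but not in `V`, and `P ≥ V` maximal without `X`. If `W` and `W'` are not below
`P`, then `X` lies in `(P ⊔ W) ⊓ (P ⊔ W') = P ⊔ (W ⊓ W')`; so `P` is prime, and its point separates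
`U` from `V`. -/
theorem le_of_forall_point {U V : Centre T} :
    letI := centreFrame hT hT'
    (∀ p : Locale.PT (Centre T), p U → p V) → U ≤ V := by
  let := centreFrame hT hT'
  intro h
  by_contra hUV
  obtain ⟨X, hXU, hXV⟩ : ∃ X, U.1.carrier X ∧ ¬ V.1.carrier X := by
    by_contra! hc
    exact hUV hc
  obtain ⟨P, hVP, hP⟩ := exists_maximal_not_mem hT hT' hXV
  have key (W : Centre T) (hW : ¬ W ≤ P) : (P ⊔ W).1.carrier X := by
    by_contra hX
    exact hW (le_sup_right.trans (hP.2 hX le_sup_left))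
  refine h (pointOfPrime P (fun ht => hP.1 (ht X ((le_top : U ≤ ⊤) X hXU))) fun W W' hWW' => ?_)
    (fun hUP => hP.1 (hUP X hXU)) hVP
  by_contra! hc
  have h₁ : ((P ⊔ W) ⊓ (P ⊔ W') : Centre T).1.carrier X := ⟨key W hc.1, key W' hc.2⟩
  rw [← sup_inf_left, sup_eq_left.2 hWW'] at h₁
  exact hP.1 h₁

theorem suppCentClass_eq (U : Centre T) :
    letI := centreFrame hT hT'
    suppCentClass T U.1.carrier = {p : SpcCent T | p U} := by
  let := centreFrame hT hT'
  ext p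
  have h₁ : p ∈ suppCentClass T U.1.carrier ↔ ¬ U ≤ sSup {W : Centre T | ¬ p W} := by
    simp only [suppCentClass, suppCent, Set.mem_iUnion, exists_prop, Set.mem_ofPred_eq]
    change _ ↔ ¬ ∀ X, U.1.carrier X → (SpcCent.prime p).carrier X
    push Not
    rfl
  -- As `p` preserves joins, the prime of `p` is the largest element on which `p` is false.
  have h₂ : ¬ p (sSup {W : Centre T | ¬ p W}) := by
    rw [map_sSup, sSup_Prop_eq]
    rintro ⟨_, ⟨W, hW, rfl⟩, h⟩
    exact hW h
  rw [h₁, Set.mem_ofPred_eq, not_iff_comm]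
  exact ⟨fun h => le_sSup h, fun h hp => h₂ (OrderHomClass.mono p h hp)⟩

end Frame

end ThickCentre

theorem mainTheorem2 {C : Type u} [Category.{v} C] [HasZeroObject C] [HasShift C ℤ]
    [Preadditive C] [∀ n : ℤ, (shiftFunctor C n).Additive] [Pretriangulated C]
    [IsTriangulated C] (T : Set (ThickCentre.Thick C)) (hT : IsSublattice T)
    (hT_join : ∀ S ⊆ T, sSup S ∈ T) :
    IsSublattice (ThickCentre.Thick.centre T) ∧
    (∀ S ⊆ ThickCentre.Thick.centre T, sSup S ∈ ThickCentre.Thick.centre T) ∧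
    (⊤ ∈ T → ⊤ ∈ ThickCentre.Thick.centre T) ∧
    (∃ frame : Order.Frame (ThickCentre.Centre T),
      (∀ U V : ThickCentre.Centre T, U ≤ V ↔ U.1 ≤ V.1) ∧
      ThickCentre.IsSpatial (ThickCentre.Centre T) ∧
      T0Space (ThickCentre.SpcCent T) ∧ QuasiSober (ThickCentre.SpcCent T) ∧
      ∃ e : ThickCentre.Centre T ≃o TopologicalSpace.Opens (ThickCentre.SpcCent T),
        ∀ U : ThickCentre.Centre T,
          (e U : Set (ThickCentre.SpcCent T)) = ThickCentre.suppCentClass T U.1.carrier) ∧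
    (∀ U ∈ T, ∀ V ∈ T, U ∈ ThickCentre.Thick.centre T ∨ V ∈ ThickCentre.Thick.centre T →
      Nonempty (ThickCentre.MayerVietoris U V)) := by
  let := ThickCentre.centreFrame hT hT_join
  refine ⟨ThickCentre.Thick.isSublattice_centre hT,
    fun S hS => ThickCentre.Thick.sSup_mem_centre hT_join hS, ThickCentre.Thick.top_mem_centre,
    ⟨ThickCentre.centreFrame hT hT_join, fun _ _ => Iff.rfl,
      ⟨ThickCentre.opensOrderIso fun _ _ => ThickCentre.le_of_forall_point hT hT_join, fun _ => rfl⟩, inferInstance, inferInstance,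
      ThickCentre.opensOrderIso fun _ _ => ThickCentre.le_of_forall_point hT hT_join,
      fun U => (ThickCentre.suppCentClass_eq hT hT_join U).symm⟩,
    fun U hU V hV h => ⟨ThickCentre.mayerVietoris ?_⟩⟩
  exact h.elim (fun h => h.2 V hV) fun h => (h.2 U hU).symm
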